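/- Call an unbounded domain \(D\subset\mathbb C\) with unbounded complement, whose boundary consists of piecewise smooth curves, a direct tract of a function \(f\), with boundary value \(R>0\), if \(f\) is holomorphic in \(D\), continuous in \(\overline D\), \(|f|=R\) on \(\partial D\) and \(|f|>R\) in \(D\). Put \(M(r,f,D)=\max_{|z|=r,\,z\in D}|f(z)|\) and let \(a(r,f,D)\) be the right derivative of \(\log M(r,f,D)\) with respect to \(\log r\). A set \(F\subset[1,\infty)\) has finite logarithmic measure if \(\int_F dt/t<\infty\). Theorem. Let \(t_0>0\) and let \(\psi:[t_0,\infty)\to(0,\infty)\) be a differentiable function with \[\int_{t_0}^\infty\frac{dt}{\psi(t)}=\infty\quad\text{and}\quad 1\le\frac{t\psi'(t)}{\psi(t)}\le L\quad(t\ge t_0)\] for some \(L<\frac65\). Then there is an entire function \(f\) which has exactly one direct tract, in the sense that for every \(R>0\) there is exactly one direct tract of \(f\) with boundary value \(R\), such that the following holds for every direct tract \(D\) of \(f\) (for whichever \(R\)). (i) For all sufficiently large \(r\) the maximum \(M(r,f,D)\) is attained, the right derivative \(a(r,f,D)\) exists and is at least \(t_0\), and for every \(z\) with \(|z|=r\)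 the open disk of radius \(r/\sqrt{\psi(a(r,f,D))}\) about \(z\) contains a zero of \(f\); in particular this disk is not contained in \(D\). (ii) Consequently, whenever \(z_r\in D\) satisfies \(|z_r|=r\) and \(|f(z_r)|=M(r,f,D)\) for all large \(r\), and \(F\) is a set of finite logarithmic measure, the relation \[f(z)\sim\Bigl(\frac z{z_r}\Bigr)^{a(r,f,D)}f(z_r)\quad\text{for }|z-z_r|\le\frac r{\sqrt{\psi(a(r,f,D))}}\] as \(r\to\infty\), \(r\notin F\) (uniformly in \(z\)), does not hold. Moreover, \(f\) can be taken of the form \(f(z)=\prod_{k=0}^\infty\bigl(1+(z/\rho_k)^{m_k}\bigr)\), converging locally uniformly in \(\mathbb C\), with \(0<\rho_0<\rho_1<\dots\), \(\rho_k\to\infty\), and integers \(m_k\ge1\). -/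

import Mathlib

open Filter Topology MeasureTheory Set
open scoped ContDiff

/-- `γ`, restricted to `[0, 1]`, is a regular injective smooth arc in the plane. -/
def IsSmoothArc (γ : ℝ → ℂ) : Prop :=
  ContDiffOn ℝ ∞ γ (Icc 0 1) ∧ InjOn γ (Icc 0 1) ∧
    ∀ t ∈ Icc (0 : ℝ) 1, derivWithin γ (Icc 0 1) t ≠ 0

/-- The set `S` consists of piecewise smooth curves: near each of its points `p` it is the union of
finitely many smooth arcs that emanate from `p` and are otherwise pairwise disjoint
(two arcs at an ordinary point or a corner, more at a point where curves of the family cross). -/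
def ConsistsOfPiecewiseSmoothCurves (S : Set ℂ) : Prop :=
  ∀ p ∈ S, ∃ U : Set ℂ, IsOpen U ∧ p ∈ U ∧ ∃ (n : ℕ) (γ : Fin n → ℝ → ℂ),
    (∀ i, IsSmoothArc (γ i) ∧ γ i 0 = p) ∧
    (∀ i j, i ≠ j → (γ i '' Icc 0 1) ∩ (γ j '' Icc 0 1) = {p}) ∧
    S ∩ U = (⋃ i, γ i '' Icc 0 1) ∩ U

/-- `D` is a direct tract of `f` with boundary value `R`: an unbounded domain with unbounded
complement whose boundary consists of piecewise smooth curves, such that `f` is holomorphic in `D`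
and continuous in the closure of `D`, with `|f| = R` on the boundary and `|f| > R` in `D`. -/
structure IsDirectTractOfLevel (f : ℂ → ℂ) (D : Set ℂ) (R : ℝ) : Prop where
  isOpen : IsOpen D
  isConnected : IsConnected D
  unbounded : ¬ Bornology.IsBounded D
  compl_unbounded : ¬ Bornology.IsBounded Dᶜ
  boundary : ConsistsOfPiecewiseSmoothCurves (frontier D)
  holomorphic : DifferentiableOn ℂ f D
  continuous : ContinuousOn f (closure D)
  level_pos : 0 < R
  norm_eq : ∀ z ∈ frontier D, ‖f z‖ = R
  lt_norm : ∀ z ∈ D, R < ‖f z‖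

/-- `D` is a direct tract of `f`. -/
def IsDirectTract (f : ℂ → ℂ) (D : Set ℂ) : Prop :=
  ∃ R : ℝ, IsDirectTractOfLevel f D R

/-- The maximum modulus `M(r, f, D)` of `f` over the points of `D` of modulus `r`. -/
noncomputable def tractMaxModulus (r : ℝ) (f : ℂ → ℂ) (D : Set ℂ) : ℝ :=
  sSup ((fun z => ‖f z‖) '' {z | z ∈ D ∧ ‖z‖ = r})

/-- `log M(r, f, D)` as a function of `x = log r`. -/
noncomputable def logTractMaxModulus (f : ℂ → ℂ) (D : Set ℂ) (x : ℝ) : ℝ :=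
  Real.log (tractMaxModulus (Real.exp x) f D)

/-- `a(r, f, D)`, the right derivative of `log M(r, f, D)` with respect to `log r`. -/
noncomputable def tractLogDeriv (r : ℝ) (f : ℂ → ℂ) (D : Set ℂ) : ℝ :=
  derivWithin (logTractMaxModulus f D) (Ioi (Real.log r)) (Real.log r)

/-- `z` is a point of `D` of modulus `r` at which `|f|` attains the value `M(r, f, D)`. -/
def IsTractMaxPoint (r : ℝ) (f : ℂ → ℂ) (D : Set ℂ) (z : ℂ) : Prop :=
  z ∈ D ∧ ‖z‖ = r ∧ ‖f z‖ = tractMaxModulus r f D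

/-- The set `F ⊆ [1, ∞)` has finite logarithmic measure. -/
def HasFiniteLogMeasure (F : Set ℝ) : Prop :=
  F ⊆ Ici 1 ∧ ∫⁻ t in F, ENNReal.ofReal (1 / t) < ⊤

/-- The Wiman-Valiron asymptotics `f(z) ∼ (z / z_r) ^ a(r, f, D) * f(z_r)`, uniformly for
`|z - z_r| ≤ r / √ψ(a(r, f, D))`, as `r → ∞`, `r ∉ F`. (The power is the principal one;
the disk is small compared with `r` when `ψ(a(r, f, D))` is large, so `z / z_r` is close to `1`.) -/
def WimanValironAsymptotics (ψ : ℝ → ℝ) (f : ℂ → ℂ) (D : Set ℂ) (zr : ℝ → ℂ) (F : Set ℝ) : Prop :=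
  ∀ ε > 0, ∀ᶠ r : ℝ in atTop, r ∉ F →
    ∀ z : ℂ, ‖z - zr r‖ ≤ r / √(ψ (tractLogDeriv r f D)) →
      ‖f z / ((z / zr r) ^ ((tractLogDeriv r f D : ℝ) : ℂ) * f (zr r)) - 1‖ < ε

/-- `f` is an infinite product `∏ (1 + (z / ρ_k) ^ m_k)`, converging locally uniformly in the plane,
with radii `0 < ρ_0 < ρ_1 < …` tending to infinity and exponents `m_k ≥ 1`. -/
def IsBinomialProduct (f : ℂ → ℂ) : Prop :=
  ∃ (ρ : ℕ → ℝ) (m : ℕ → ℕ), (∀ k, 0 < ρ k) ∧ StrictMono ρ ∧ Tendsto ρ atTop atTop ∧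
    (∀ k, 1 ≤ m k) ∧
    HasProdLocallyUniformlyOn (fun (k : ℕ) (z : ℂ) => 1 + (z / (ρ k : ℂ)) ^ m k) f univ

/-! Asymptotics of Wiman-Valiron type would make `f` zero-free on the disk about `z_r`, so it is
enough to spread zeros densely compared with the growth of `f`. Put φ = √ψ. The factor of index k
has m_k equally spaced zeros on the circle of radius exp(x_k). Let n_k be a large constant plus the
sum of the earlier exponents, m_k = ⌈64 φ(n_k)⌉ and x_{k+1} - x_k = 1/(16 φ(n_k)). Every point with
x_k ≤ log|z| ≤ x_{k+1} then has a zero within 1/(8 φ(n_k)) in logarithmic coordinates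
(`exists_zero`).

The maximum modulus is attained on the positive axis (`norm_le`), so a(r) is a sum over the factors
(`hasDerivAt_log_norm`). Those beyond the current circle contribute a geometric tail, whence a(r) ≤
2 n_k and √ψ(a(r)) ≤ 2 φ(n_k), so the disk reaches the zero. The bound L < 6/5 makes √ψ(t) small
against t and limits its growth under doubling; divergence of ∫ dt/ψ gives x_k → ∞
(`tendsto_logRadius`).

Since m_k (x_{k+1} - x_k) ≥ 4, the product exceeds any bound on suitable circles between the circles
of zeros (`two_pow_le_norm`). By the maximum principle {|f| > R} is then connected, and it is the
only tract of level R (`isDirectTractOfLevel_iff`). -/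

/-! ### Growth of ψ -/

section Growth

variable {t₀ : ℝ} {ψ : ℝ → ℝ}

lemma monotoneOn_div_self_of_logDeriv_ge (ht₀ : 0 < t₀) (hpos : ∀ t ∈ Ici t₀, 0 < ψ t)
    (hdiff : DifferentiableOn ℝ ψ (Ici t₀))
    (hreg : ∀ t ∈ Ici t₀, 1 ≤ t * derivWithin ψ (Ici t₀) t / ψ t) :
    MonotoneOn (fun t => ψ t / t) (Ici t₀) := by
  have hne : ∀ t ∈ Ici t₀, t ≠ 0 := fun t ht => (ht₀.trans_le ht).ne'
  refine monotoneOn_of_deriv_nonneg (convex_Ici _)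
    (hdiff.continuousOn.div continuousOn_id hne) ?_ ?_
  · exact (hdiff.div differentiableOn_id hne).mono interior_subset
  · intro t ht
    rw [interior_Ici] at ht
    have htI : t ∈ Ici t₀ := (mem_Ioi.1 ht).le
    have hd : HasDerivAt ψ (derivWithin ψ (Ici t₀) t) t :=
      ((hdiff t htI).hasDerivWithinAt).hasDerivAt (Ici_mem_nhds ht)
    have h := hd.fun_div (hasDerivAt_id' t) (hne t htI)
    rw [h.deriv]
    have h1 := hreg t htI
    rw [le_div_iff₀ (hpos t htI)] at h1
    apply div_nonneg _ (sq_nonneg _)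
    linarith

/-- The fifth power of ψ(t)/t^{6/5}, written so to keep integer exponents. -/
lemma antitoneOn_pow_div_pow_of_logDeriv_le (ht₀ : 0 < t₀) (hpos : ∀ t ∈ Ici t₀, 0 < ψ t)
    (hdiff : DifferentiableOn ℝ ψ (Ici t₀))
    (hreg : ∀ t ∈ Ici t₀, t * derivWithin ψ (Ici t₀) t / ψ t ≤ 6 / 5) :
    AntitoneOn (fun t => ψ t ^ 5 / t ^ 6) (Ici t₀) := by
  have hne : ∀ t ∈ Ici t₀, t ^ 6 ≠ 0 := fun t ht => (pow_pos (ht₀.trans_le ht) 6).ne'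
  refine antitoneOn_of_deriv_nonpos (convex_Ici _)
    ((hdiff.continuousOn.pow 5).div (continuousOn_id.pow 6) hne) ?_ ?_
  · exact ((hdiff.pow 5).div (differentiableOn_id.pow 6) hne).mono interior_subset
  · intro t ht
    rw [interior_Ici] at ht
    have htI : t ∈ Ici t₀ := (mem_Ioi.1 ht).le
    have htp : 0 < t := ht₀.trans_le htI
    have hd : HasDerivAt ψ (derivWithin ψ (Ici t₀) t) t :=
      ((hdiff t htI).hasDerivWithinAt).hasDerivAt (Ici_mem_nhds ht)
    have h := (hd.fun_pow 5).fun_div (hasDerivAt_pow 6 t) (hne t htI)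
    rw [h.deriv]
    have h1 := hreg t htI
    rw [div_le_iff₀ (hpos t htI)] at h1
    apply div_nonpos_of_nonpos_of_nonneg _ (sq_nonneg _)
    have h2 : 0 < ψ t ^ 4 * t ^ 5 := mul_pos (pow_pos (hpos t htI) 4) (pow_pos htp 5)
    have h3 := mul_le_mul_of_nonneg_left h1 h2.le
    push_cast
    nlinarith [h3]

/-- For large arguments `√ψ` is at least `1`, at most doubles when its argument doubles, and is
small compared with its argument. -/
lemma exists_nat_sqrt_growth (ht₀ : 0 < t₀) (hpos : ∀ t ∈ Ici t₀, 0 < ψ t)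
    (hmono : MonotoneOn (fun t => ψ t / t) (Ici t₀))
    (hanti : AntitoneOn (fun t => ψ t ^ 5 / t ^ 6) (Ici t₀)) :
    ∃ N : ℕ, t₀ ≤ N ∧ ∀ t : ℝ, (N : ℝ) ≤ t → 1 ≤ √(ψ t) ∧ √(ψ (2 * t)) ≤ 2 * √(ψ t) ∧
      5 * (⌈64 * √(ψ t)⌉₊ : ℝ) ≤ t := by
  have hc : 0 < ψ t₀ / t₀ := div_pos (hpos _ self_mem_Ici) ht₀
  set c := ψ t₀ / t₀ with hcdef
  set K := ψ t₀ ^ 5 / t₀ ^ 6 with hK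
  have hlarge : ∀ᶠ t : ℝ in atTop, t₀ ≤ t ∧ 1 / c ≤ t ∧ K * 400 ^ 10 ≤ t ∧ 1 ≤ t :=
    (eventually_ge_atTop _).and ((eventually_ge_atTop _).and
      ((eventually_ge_atTop _).and (eventually_ge_atTop _)))
  obtain ⟨T, hT⟩ := eventually_atTop.1 hlarge
  refine ⟨⌈max T t₀⌉₊, (le_max_right _ _).trans (Nat.le_ceil _), fun t ht => ?_⟩
  obtain ⟨h1, h2, h3, h4⟩ := hT t (((le_max_left _ _).trans (Nat.le_ceil _)).trans ht)
  have htp : 0 < t := by linarith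
  have hψ := hpos t h1
  have hone : 1 ≤ ψ t := by
    have := hmono self_mem_Ici h1 h1
    simp only [← hcdef] at this
    rw [le_div_iff₀ htp] at this
    rw [div_le_iff₀ hc] at h2
    linarith
  have hsq1 : 1 ≤ √(ψ t) := Real.one_le_sqrt.2 hone
  refine ⟨hsq1, ?_, ?_⟩
  · have h2t : 2 * t ∈ Ici t₀ := by simp only [mem_Ici]; linarith
    have := hanti h1 h2t (by linarith)
    simp only at this
    rw [div_le_div_iff₀ (by positivity) (by positivity)] at this
    have h6 : ψ (2 * t) ^ 5 ≤ (4 * ψ t) ^ 5 := by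
      have h7 : ψ (2 * t) ^ 5 ≤ 64 * ψ t ^ 5 := by
        have h8 : ψ (2 * t) ^ 5 * t ^ 6 ≤ (64 * ψ t ^ 5) * t ^ 6 := by
          nlinarith [this]
        exact le_of_mul_le_mul_right h8 (by positivity)
      have : 0 < ψ t ^ 5 := by positivity
      nlinarith
    have h7 : ψ (2 * t) ≤ 4 * ψ t := le_of_pow_le_pow_left₀ (by norm_num) (by positivity) h6
    calc √(ψ (2 * t)) ≤ √(4 * ψ t) := Real.sqrt_le_sqrt h7
      _ = 2 * √(ψ t) := by
        rw [Real.sqrt_mul (by norm_num), show (4 : ℝ) = 2 ^ 2 by norm_num,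
          Real.sqrt_sq (by norm_num)]
  · have h5 := hanti self_mem_Ici h1 h1
    simp only [← hK] at h5
    rw [div_le_iff₀ (by positivity)] at h5
    -- Tenth powers: ψ^5 is O(t^6), leaving t^4 to absorb the constant. With s = √(ψ t) ≥ 1, the 400
    -- then gives 5 (64 s + 1) ≤ 325 s ≤ t.
    have h6 : √(ψ t) ≤ t / 400 := by
      refine le_of_pow_le_pow_left₀ (n := 10) (by norm_num) (by positivity) ?_
      have : √(ψ t) ^ 10 = ψ t ^ 5 := by
        rw [show (10 : ℕ) = 2 * 5 by norm_num, pow_mul, Real.sq_sqrt hψ.le]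
      rw [this, div_pow, le_div_iff₀ (by positivity)]
      have h7 : t ≤ t ^ 4 := le_self_pow₀ h4 (by norm_num)
      calc ψ t ^ 5 * 400 ^ 10 ≤ K * t ^ 6 * 400 ^ 10 := by gcongr
        _ = (K * 400 ^ 10) * t ^ 6 := by ring
        _ ≤ t ^ 4 * t ^ 6 := by gcongr; linarith
        _ = t ^ 10 := by ring
    have h7 : (⌈64 * √(ψ t)⌉₊ : ℝ) < 64 * √(ψ t) + 1 := Nat.ceil_lt_add_one (by positivity)
    linarith

end Growth

/-! ### Exponents and radii -/

/-- Exponents `m` and logarithms of radii `x` such that consecutive factors of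
`∏ (1 + (z / exp (x k)) ^ m k)` are uniformly separated. -/
structure IsSeparatedSystem (m : ℕ → ℕ) (x : ℕ → ℝ) : Prop where
  monotone : Monotone m
  one_le : ∀ k, 1 ≤ m k
  gap : ∀ k, 4 ≤ (m k : ℝ) * (x (k + 1) - x k)
  tendsto : Tendsto x atTop atTop

/-- The counting sequence `n` with increments `⌈64 φ (n k)⌉`. -/
noncomputable def countSeq (φ : ℝ → ℝ) (N : ℕ) : ℕ → ℕ
  | 0 => N
  | k + 1 => countSeq φ N k + ⌈64 * φ (countSeq φ N k)⌉₊

/-- The logarithms of the radii belonging to `countSeq`. -/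
noncomputable def logRadius (φ : ℝ → ℝ) (N : ℕ) (k : ℕ) : ℝ :=
  ∑ i ∈ Finset.range k, 1 / (16 * φ (countSeq φ N i))

lemma countSeq_monotone (φ : ℝ → ℝ) (N : ℕ) : Monotone (countSeq φ N) :=
  monotone_nat_of_le_succ fun k => by simp [countSeq]

lemma logRadius_succ_sub (φ : ℝ → ℝ) (N k : ℕ) :
    logRadius φ N (k + 1) - logRadius φ N k = 1 / (16 * φ (countSeq φ N k)) := by
  simp [logRadius, Finset.sum_range_succ]

lemma sum_range_ceil_countSeq (φ : ℝ → ℝ) (N k : ℕ) :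
    ∑ i ∈ Finset.range k, ⌈64 * φ (countSeq φ N i)⌉₊ + N = countSeq φ N k := by
  induction k with
  | zero => simp [countSeq]
  | succ k ih => rw [Finset.sum_range_succ, countSeq, ← ih]; ring

/-- A step of `countSeq` has length at most 65 φ, so ∫ dt/ψ over it is at most 65/φ, which is 1040 =
16 · 65 times the increment of `logRadius`. -/
lemma tendsto_logRadius {ψ : ℝ → ℝ} {t₀ : ℝ} {N : ℕ} (hN : t₀ ≤ N)
    (hpos : ∀ t ∈ Ici t₀, 0 < ψ t) (hcont : ContinuousOn ψ (Ici t₀))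
    (hmono : MonotoneOn ψ (Ici t₀)) (hone : ∀ t : ℝ, (N : ℝ) ≤ t → 1 ≤ √(ψ t))
    (hdiv : Tendsto (fun T : ℝ => ∫ t in t₀..T, 1 / ψ t) atTop atTop) :
    Tendsto (logRadius (fun t => √(ψ t)) N) atTop atTop := by
  set φ : ℝ → ℝ := fun t => √(ψ t) with hφ
  set n := countSeq φ N with hn
  have hNn : ∀ k, (N : ℝ) ≤ n k := fun k => by
    exact_mod_cast (countSeq_monotone φ N (Nat.zero_le k) : countSeq φ N 0 ≤ _)
  have hφ1 : ∀ k, 1 ≤ φ (n k) := fun k => hone _ (hNn k)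
  have htn : ∀ k, t₀ ≤ n k := fun k => hN.trans (hNn k)
  have hInt : ∀ a ∈ Ici t₀, ∀ b ∈ Ici t₀, IntervalIntegrable (fun t => 1 / ψ t) volume a b := by
    intro a ha b hb
    have hsub : uIcc a b ⊆ Ici t₀ := by
      intro y hy
      rw [mem_uIcc] at hy
      simp only [mem_Ici] at *
      rcases hy with hy | hy <;> linarith [hy.1]
    exact (continuousOn_const.div (hcont.mono hsub)
      fun y hy => (hpos y (hsub hy)).ne').intervalIntegrable
  have hstep : ∀ k, ∫ t in (n k : ℝ)..n (k + 1), 1 / ψ t ≤ 65 / φ (n k) := by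
    intro k
    have hle : (n k : ℝ) ≤ n (k + 1) := by
      exact_mod_cast countSeq_monotone φ N (Nat.le_succ k)
    have h1 : ∫ t in (n k : ℝ)..n (k + 1), 1 / ψ t
        ≤ ∫ t in (n k : ℝ)..n (k + 1), 1 / ψ (n k) := by
      refine intervalIntegral.integral_mono_on hle (hInt _ (htn k) _ (htn _))
        intervalIntegrable_const fun t ht => ?_
      exact one_div_le_one_div_of_le (hpos _ (htn k))
        (hmono (htn k) ((htn k).trans ht.1) ht.1)
    refine h1.trans ?_
    have h2 : ((n (k + 1) : ℕ) : ℝ) - n k ≤ 65 * φ (n k) := by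
      have h3 : n (k + 1) = n k + ⌈64 * φ (n k)⌉₊ := rfl
      have h4 : (⌈64 * φ (n k)⌉₊ : ℝ) < 64 * φ (n k) + 1 :=
        Nat.ceil_lt_add_one (by linarith [hφ1 k])
      rw [h3]; push_cast
      linarith [hφ1 k]
    have h5 : ψ (n k) = φ (n k) ^ 2 := (Real.sq_sqrt (hpos _ (htn k)).le).symm
    have h6 : 0 < φ (n k) := by linarith [hφ1 k]
    rw [intervalIntegral.integral_const, smul_eq_mul, h5, mul_one_div,
      div_le_div_iff₀ (by positivity) h6]
    nlinarith
  have hsum : ∀ k, ∫ t in t₀..(n k : ℝ), 1 / ψ t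
      ≤ (∫ t in t₀..(N : ℝ), 1 / ψ t) + 1040 * logRadius φ N k := by
    intro k
    induction k with
    | zero => simp [hn, countSeq, logRadius]
    | succ k ih =>
      rw [← intervalIntegral.integral_add_adjacent_intervals
        (hInt _ self_mem_Ici _ (htn k)) (hInt _ (htn k) _ (htn (k + 1)))]
      have h1 := hstep k
      have h2 := logRadius_succ_sub φ N k
      have h3 : 1040 * (1 / (16 * φ (countSeq φ N k))) = 65 / φ (n k) := by
        have : φ (n k) ≠ 0 := by linarith [hφ1 k]
        rw [← hn]; field_simp; norm_num
      linarith
  have hnk : ∀ k, k ≤ n k := by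
    intro k
    induction k with
    | zero => simp
    | succ k ih =>
      have h3 : n (k + 1) = n k + ⌈64 * φ (n k)⌉₊ := rfl
      have h4 : 0 < ⌈64 * φ (n k)⌉₊ := Nat.ceil_pos.2 (by linarith [hφ1 k])
      omega
  have hntop : Tendsto (fun k => (n k : ℝ)) atTop atTop :=
    tendsto_natCast_atTop_atTop.comp (tendsto_atTop_mono hnk tendsto_id)
  have h1 := tendsto_atTop_mono hsum (hdiv.comp hntop)
  have h2 := (tendsto_atTop_add_const_left atTop (-(∫ t in t₀..(N : ℝ), 1 / ψ t)) h1)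
  have h3 := h2.atTop_mul_const (show (0 : ℝ) < 1 / 1040 by norm_num)
  refine h3.congr fun k => ?_
  ring

/-- The sequences used in the construction. -/
theorem exists_isSeparatedSystem {t₀ L : ℝ} {ψ : ℝ → ℝ} (ht₀ : 0 < t₀)
    (hpos : ∀ t ∈ Ici t₀, 0 < ψ t) (hdiff : DifferentiableOn ℝ ψ (Ici t₀))
    (hdiv : Tendsto (fun T : ℝ => ∫ t in t₀..T, 1 / ψ t) atTop atTop)
    (hreg : ∀ t ∈ Ici t₀, 1 ≤ t * derivWithin ψ (Ici t₀) t / ψ t ∧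
      t * derivWithin ψ (Ici t₀) t / ψ t ≤ L)
    (hL : L < 6 / 5) :
    MonotoneOn ψ (Ici t₀) ∧
    ∃ (m n : ℕ → ℕ) (x : ℕ → ℝ), IsSeparatedSystem m x ∧ ∀ k, m (k + 1) ≤ 2 * m k ∧
      ∑ i ∈ Finset.range (k + 1), m i + 4 * m k ≤ 2 * n k ∧ t₀ ≤ n k ∧
      x (k + 1) - x k = 1 / (16 * √(ψ (n k))) ∧ 64 * √(ψ (n k)) ≤ m k ∧
      1 ≤ √(ψ (n k)) ∧ √(ψ (2 * n k)) ≤ 2 * √(ψ (n k)) := by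
  have hm := monotoneOn_div_self_of_logDeriv_ge ht₀ hpos hdiff fun t ht => (hreg t ht).1
  have ha := antitoneOn_pow_div_pow_of_logDeriv_le ht₀ hpos hdiff
    fun t ht => (hreg t ht).2.trans hL.le
  have hmono : MonotoneOn ψ (Ici t₀) := by
    intro s hs t ht hst
    have h := hm hs ht hst
    simp only at h
    have hs0 : 0 < s := ht₀.trans_le hs
    have ht0 : 0 < t := ht₀.trans_le ht
    rw [div_le_div_iff₀ hs0 ht0] at h
    have : ψ s * s ≤ ψ t * s := le_trans (by gcongr; exact (hpos s hs).le) h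
    exact le_of_mul_le_mul_right this hs0
  obtain ⟨N, hN, hg⟩ := exists_nat_sqrt_growth ht₀ hpos hm ha
  set φ : ℝ → ℝ := fun t => √(ψ t) with hφ
  set n := countSeq φ N with hn
  have hNn : ∀ k, (N : ℝ) ≤ n k := fun k => by
    exact_mod_cast (countSeq_monotone φ N (Nat.zero_le k) : countSeq φ N 0 ≤ _)
  have htn : ∀ k, t₀ ≤ n k := fun k => hN.trans (hNn k)
  have hφ1 : ∀ k, 1 ≤ φ (n k) := fun k => (hg _ (hNn k)).1
  have hφm : ∀ s t : ℝ, t₀ ≤ s → s ≤ t → φ s ≤ φ t := fun s t hs hst =>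
    Real.sqrt_le_sqrt (hmono hs (hs.trans hst) hst)
  -- One of the five copies passes from `n k` to `n (k + 1)`; the other four pay for `4 * m k`,
  -- which will bound the tail of the logarithmic derivative.
  have hn2 : ∀ k, n k + 5 * ⌈64 * φ (n k)⌉₊ ≤ 2 * n k := fun k => by
    have : 5 * ⌈64 * φ (n k)⌉₊ ≤ n k := by exact_mod_cast (hg _ (hNn k)).2.2
    omega
  have hsucc : ∀ k, n (k + 1) = n k + ⌈64 * φ (n k)⌉₊ := fun k => rfl
  refine ⟨hmono, fun k => ⌈64 * φ (n k)⌉₊, n, logRadius φ N, ⟨?_, ?_, ?_, ?_⟩, fun k =>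
    ⟨?_, ?_, htn k, logRadius_succ_sub φ N k, Nat.le_ceil _, hφ1 k, (hg _ (hNn k)).2.1⟩⟩
  · intro i j hij
    refine Nat.ceil_mono ?_
    have := hφm (n i) (n j) (htn i) (by exact_mod_cast countSeq_monotone φ N hij)
    linarith
  · intro k
    exact Nat.ceil_pos.2 (by linarith [hφ1 k])
  · intro k
    rw [logRadius_succ_sub, ← hn]
    have h1 := hφ1 k
    have h2 : 64 * φ (n k) ≤ (⌈64 * φ (n k)⌉₊ : ℝ) := Nat.le_ceil _
    rw [mul_one_div, le_div_iff₀ (by linarith)]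
    linarith
  · exact tendsto_logRadius hN hpos hdiff.continuousOn hmono (fun t ht => (hg t ht).1) hdiv
  · refine Nat.ceil_le.2 ?_
    have h1 : φ (n (k + 1)) ≤ φ (2 * n k) := by
      refine hφm _ _ (htn _) ?_
      have := hn2 k
      have h2 := hsucc k
      exact_mod_cast (by omega : n (k + 1) ≤ 2 * n k)
    have h2 := (hg _ (hNn k)).2.1
    have h3 : 64 * φ (n k) ≤ (⌈64 * φ (n k)⌉₊ : ℝ) := Nat.le_ceil _
    push_cast
    linarith
  · have h1 := sum_range_ceil_countSeq φ N (k + 1)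
    have h2 := hn2 k
    have h3 := hsucc k
    simp only [← hn] at h1 ⊢
    omega

/-! ### The product: convergence, size and zeros -/

/-- The product `∏ (1 + (z / exp (x k)) ^ m k)`. -/
noncomputable def binomialProduct (m : ℕ → ℕ) (x : ℕ → ℝ) (z : ℂ) : ℂ :=
  ∏' k, (1 + (z / (Real.exp (x k) : ℂ)) ^ m k)

lemma norm_div_exp_pow {z : ℂ} {y : ℝ} (hz : ‖z‖ = Real.exp y) (s : ℝ) (n : ℕ) :
    ‖(z / (Real.exp s : ℂ)) ^ n‖ = Real.exp (n * (y - s)) := by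
  rw [norm_pow, norm_div, hz, Complex.norm_real, Real.norm_of_nonneg (Real.exp_pos _).le,
    ← Real.exp_sub, ← Real.exp_nat_mul]

lemma Real.exp_neg_four_mul_le (i : ℕ) : Real.exp (-(4 * i)) ≤ (1 / 4) ^ i := by
  rw [show -(4 * (i : ℝ)) = i * (-4) by ring, Real.exp_nat_mul]
  gcongr
  rw [Real.exp_neg, one_div]
  gcongr
  linarith [Real.add_one_le_exp (4 : ℝ)]

namespace IsSeparatedSystem

variable {m : ℕ → ℕ} {x : ℕ → ℝ} (h : IsSeparatedSystem m x)
include h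

lemma strictMono : StrictMono x := by
  refine strictMono_nat_of_lt_succ fun k => ?_
  have h1 := h.gap k
  by_contra! h2
  have : (m k : ℝ) * (x (k + 1) - x k) ≤ 0 :=
    mul_nonpos_of_nonneg_of_nonpos (Nat.cast_nonneg _) (by linarith)
  linarith

/-- Each gap is at least 4 when weighted by its own exponent, hence also with the larger common
weight `M`; the gaps then add up. -/
lemma four_mul_le {i d : ℕ} {M : ℝ} (hM : m (i + d) ≤ M) : 4 * d ≤ M * (x (i + d) - x i) := by
  induction d with
  | zero => simp
  | succ d ih =>
    have h1 : (m (i + d) : ℝ) ≤ M :=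
      le_trans (by exact_mod_cast h.monotone (by omega)) hM
    have h2 := ih h1
    have h3 := h.gap (i + d)
    have h4 : 0 ≤ x (i + d + 1) - x (i + d) := sub_nonneg.2 (h.strictMono (Nat.lt_succ_self _)).le
    have h5 := mul_le_mul_of_nonneg_right h1 h4
    rw [← add_assoc]
    push_cast
    linarith

lemma exponent_le {y : ℝ} {k : ℕ} (hy : y ≤ x k) (i : ℕ) :
    m (k + i) * (y - x (k + i)) ≤ -(4 * i) := by
  have h1 := h.four_mul_le (i := k) (d := i) le_rfl
  have h2 : (m (k + i) : ℝ) * (y - x (k + i)) ≤ m (k + i) * (x k - x (k + i)) := by gcongr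
  linarith

lemma exp_exponent_le {y : ℝ} {k : ℕ} (hy : y ≤ x k) (i : ℕ) :
    Real.exp (m (k + i) * (y - x (k + i))) ≤ (1 / 4) ^ i :=
  (Real.exp_le_exp.2 (h.exponent_le hy i)).trans (Real.exp_neg_four_mul_le i)

lemma norm_pow_le {z : ℂ} {k : ℕ} (hz : ‖z‖ ≤ Real.exp (x k)) (i : ℕ) :
    ‖(z / (Real.exp (x (k + i)) : ℂ)) ^ m (k + i)‖ ≤ (1 / 4) ^ i := by
  refine le_trans ?_ (h.exp_exponent_le (le_refl (x k)) i)
  rw [norm_pow, norm_div, Complex.norm_real, Real.norm_of_nonneg (Real.exp_pos _).le,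
    Real.exp_nat_mul, Real.exp_sub]
  gcongr

lemma hasProdLocallyUniformlyOn :
    HasProdLocallyUniformlyOn (fun (k : ℕ) (z : ℂ) => 1 + (z / (Real.exp (x k) : ℂ)) ^ m k)
      (binomialProduct m x) univ := by
  refine hasProdLocallyUniformlyOn_of_forall_compact isOpen_univ fun K _ hK => ?_
  obtain ⟨C, hC⟩ := hK.isBounded.exists_norm_le
  obtain ⟨k, hk⟩ := ((Real.tendsto_exp_atTop.comp h.tendsto).eventually_ge_atTop C).exists
  have hu : Summable fun j : ℕ => (1 / 4 : ℝ) ^ (j - k) := by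
    rw [← summable_nat_add_iff k]
    simpa using summable_geometric_of_lt_one (r := (1 / 4 : ℝ)) (by norm_num) (by norm_num)
  refine Summable.hasProdUniformlyOn_nat_one_add hK hu ?_ fun j => by fun_prop
  filter_upwards [eventually_ge_atTop k] with j hj z hz
  obtain ⟨i, rfl⟩ := Nat.exists_eq_add_of_le hj
  simpa using h.norm_pow_le ((hC z hz).trans hk) i

lemma differentiable : Differentiable ℂ (binomialProduct m x) := by
  rw [← differentiableOn_univ]
  refine (hasProdLocallyUniformlyOn_iff_tendstoLocallyUniformlyOn.1
    h.hasProdLocallyUniformlyOn).differentiableOn (.of_forall fun s => ?_) isOpen_univ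
  fun_prop

lemma isBinomialProduct : IsBinomialProduct (binomialProduct m x) :=
  ⟨fun k => Real.exp (x k), m, fun _ => Real.exp_pos _, Real.exp_strictMono.comp h.strictMono,
    Real.tendsto_exp_atTop.comp h.tendsto, h.one_le, h.hasProdLocallyUniformlyOn⟩

lemma tendsto_prod_range (z : ℂ) :
    Tendsto (fun n => ∏ k ∈ Finset.range n, (1 + (z / (Real.exp (x k) : ℂ)) ^ m k)) atTop
      (𝓝 (binomialProduct m x z)) :=
  (h.hasProdLocallyUniformlyOn.hasProd (mem_univ z)).tendsto_prod_nat

/-- On the positive axis the product takes positive values. -/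
lemma ofReal_value {r : ℝ} (hr : 0 ≤ r) :
    (binomialProduct m x r).im = 0 ∧
      1 + (r / Real.exp (x 0)) ^ m 0 ≤ (binomialProduct m x r).re := by
  have hcl : IsClosed {w : ℂ | w.im = 0 ∧ 1 + (r / Real.exp (x 0)) ^ m 0 ≤ w.re} :=
    (isClosed_eq Complex.continuous_im continuous_const).inter
      (isClosed_le continuous_const Complex.continuous_re)
  refine hcl.mem_of_tendsto (h.tendsto_prod_range r) ?_
  filter_upwards [eventually_ge_atTop 1] with n hn
  have hcast : ∏ k ∈ Finset.range n, (1 + ((r : ℂ) / (Real.exp (x k) : ℂ)) ^ m k)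
      = ((∏ k ∈ Finset.range n, (1 + (r / Real.exp (x k)) ^ m k) : ℝ) : ℂ) := by
    push_cast; rfl
  rw [hcast]
  refine ⟨Complex.ofReal_im _, ?_⟩
  rw [Complex.ofReal_re]
  obtain ⟨n, rfl⟩ := Nat.exists_eq_add_of_le' hn
  rw [Finset.prod_range_succ']
  have h1 : (1 : ℝ) ≤ ∏ k ∈ Finset.range n, (1 + (r / Real.exp (x (k + 1))) ^ m (k + 1)) := by
    refine Finset.prod_induction _ (fun a : ℝ => 1 ≤ a) (fun a b ha hb => one_le_mul_of_one_le_of_one_le ha hb)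
      le_rfl fun i _ => ?_
    have : 0 ≤ (r / Real.exp (x (i + 1))) ^ m (i + 1) := by positivity
    linarith
  have h2 : 0 ≤ 1 + (r / Real.exp (x 0)) ^ m 0 := by positivity
  exact le_mul_of_one_le_left h2 h1

lemma norm_ofReal {r : ℝ} (hr : 0 ≤ r) :
    ‖binomialProduct m x r‖ = (binomialProduct m x r).re := by
  obtain ⟨h1, h2⟩ := h.ofReal_value hr
  have h3 : 0 ≤ (r / Real.exp (x 0)) ^ m 0 := by positivity
  rw [← Complex.abs_re_eq_norm.2 h1, abs_of_nonneg (by linarith)]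

lemma norm_le (z : ℂ) : ‖binomialProduct m x z‖ ≤ ‖binomialProduct m x (‖z‖ : ℝ)‖ := by
  refine le_of_tendsto_of_tendsto' (h.tendsto_prod_range z).norm
    (h.tendsto_prod_range (‖z‖ : ℝ)).norm fun n => ?_
  rw [norm_prod, norm_prod]
  refine Finset.prod_le_prod (fun _ _ => norm_nonneg _) fun k _ => ?_
  refine (norm_add_le _ _).trans ?_
  have : (1 : ℂ) + (((‖z‖ : ℝ) : ℂ) / (Real.exp (x k) : ℂ)) ^ m k
      = ((1 + (‖z‖ / Real.exp (x k)) ^ m k : ℝ) : ℂ) := by push_cast; rfl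
  rw [this, Complex.norm_real, Real.norm_of_nonneg (by positivity), norm_one, norm_pow, norm_div,
    Complex.norm_real, Real.norm_of_nonneg (Real.exp_pos _).le]

lemma tendsto_norm_ofReal : Tendsto (fun r : ℝ => ‖binomialProduct m x r‖) atTop atTop := by
  have h1 : Tendsto (fun r : ℝ => (r / Real.exp (x 0)) ^ m 0) atTop atTop :=
    (tendsto_pow_atTop (by have := h.one_le 0; omega)).comp
      (tendsto_id.atTop_div_const (Real.exp_pos _))
  refine tendsto_atTop_mono' _ ?_ h1
  filter_upwards [eventually_ge_atTop 0] with r hr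
  rw [h.norm_ofReal hr]
  linarith [(h.ofReal_value hr).2]

omit h in
-- The bare bound 1/2 does not survive induction; the extra term absorbs the next factor.
lemma half_le_prod_one_sub_geometric (n : ℕ) :
    1 / 2 + 1 / 2 * (1 / 4 : ℝ) ^ n ≤ ∏ i ∈ Finset.range n, (1 - 1 / 3 * (1 / 4 : ℝ) ^ i) := by
  induction n with
  | zero => norm_num
  | succ n ih =>
    rw [Finset.prod_range_succ, pow_succ]
    have h0 : (0 : ℝ) < (1 / 4) ^ n := by positivity
    have h1 : (1 / 4 : ℝ) ^ n ≤ 1 := pow_le_one₀ (by norm_num) (by norm_num)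
    set q := (1 / 4 : ℝ) ^ n
    have h2 := mul_le_mul_of_nonneg_right ih (show 0 ≤ 1 - 1 / 3 * q by linarith)
    nlinarith

/-- Half way (logarithmically) between consecutive radii the product is large. -/
lemma two_pow_le_norm {k : ℕ} {z : ℂ} (hz : ‖z‖ = Real.exp ((x k + x (k + 1)) / 2)) :
    (2 : ℝ) ^ k ≤ ‖binomialProduct m x z‖ := by
  refine ge_of_tendsto (h.tendsto_prod_range z).norm ?_
  filter_upwards [eventually_ge_atTop (k + 1)] with N hN
  obtain ⟨n, rfl⟩ := Nat.exists_eq_add_of_le hN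
  rw [norm_prod, Finset.prod_range_add]
  have hmono := h.strictMono.monotone
  have h1 : (2 : ℝ) ^ (k + 1)
      ≤ ∏ j ∈ Finset.range (k + 1), ‖1 + (z / (Real.exp (x j) : ℂ)) ^ m j‖ := by
    have : (2 : ℝ) ^ (k + 1) = ∏ j ∈ Finset.range (k + 1), (2 : ℝ) := by simp
    rw [this]
    refine Finset.prod_le_prod (fun _ _ => by norm_num) fun j hj => ?_
    have hj' : j + 1 ≤ k + 1 := by simpa using hj
    have h2 := norm_sub_le (1 + (z / (Real.exp (x j) : ℂ)) ^ m j) 1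
    rw [add_sub_cancel_left, norm_div_exp_pow hz, norm_one] at h2
    -- The point lies at least half a gap beyond `x j`, and half of 4 is 2; then exp 2 - 1 ≥ 2.
    have h3 : (2 : ℝ) ≤ m j * ((x k + x (k + 1)) / 2 - x j) := by
      have h4 := h.gap j
      have h5 : x j ≤ x k := hmono (by omega)
      have h6 : x (j + 1) ≤ x (k + 1) := hmono hj'
      have h7 : (m j : ℝ) * ((x (j + 1) - x j) / 2) ≤ m j * ((x k + x (k + 1)) / 2 - x j) := by
        gcongr; linarith
      linarith
    linarith [Real.add_one_le_exp ((m j : ℝ) * ((x k + x (k + 1)) / 2 - x j))]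
  have h2 : (1 / 2 : ℝ)
      ≤ ∏ i ∈ Finset.range n, ‖1 + (z / (Real.exp (x (k + 1 + i)) : ℂ)) ^ m (k + 1 + i)‖ := by
    have h0 : (0 : ℝ) < (1 / 4) ^ n := by positivity
    refine le_trans (by linarith) ((half_le_prod_one_sub_geometric n).trans ?_)
    refine Finset.prod_le_prod (fun i _ => ?_) fun i _ => ?_
    · have h1 : (1 / 4 : ℝ) ^ i ≤ 1 := pow_le_one₀ (by norm_num) (by norm_num)
      linarith
    have h3 := norm_sub_le (1 + (z / (Real.exp (x (k + 1 + i)) : ℂ)) ^ m (k + 1 + i))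
      ((z / (Real.exp (x (k + 1 + i)) : ℂ)) ^ m (k + 1 + i))
    rw [add_sub_cancel_right, norm_div_exp_pow hz, norm_one] at h3
    have h4 := h.exp_exponent_le (le_refl (x (k + 1))) i
    -- The half gap up to `x (k + 1)` supplies exp(-2) ≤ 1/3, the constant in
    -- `half_le_prod_one_sub_geometric`.
    have h5 : (m (k + 1 + i) : ℝ) * ((x k + x (k + 1)) / 2 - x (k + 1)) ≤ -2 := by
      have h6 := h.gap k
      have h7 : (m k : ℝ) ≤ m (k + 1 + i) := by exact_mod_cast h.monotone (by omega)
      have h8 : x k ≤ x (k + 1) := hmono (by omega)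
      have h9 := mul_le_mul_of_nonneg_right h7 (sub_nonneg.2 h8)
      linarith
    have h6 : Real.exp (m (k + 1 + i) * ((x k + x (k + 1)) / 2 - x (k + 1 + i)))
        ≤ 1 / 3 * (1 / 4) ^ i := by
      have : (m (k + 1 + i) : ℝ) * ((x k + x (k + 1)) / 2 - x (k + 1 + i))
        = m (k + 1 + i) * ((x k + x (k + 1)) / 2 - x (k + 1))
          + m (k + 1 + i) * (x (k + 1) - x (k + 1 + i)) := by ring
      rw [this, Real.exp_add]
      gcongr
      refine (Real.exp_le_exp.2 h5).trans ?_
      rw [Real.exp_neg, one_div]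
      gcongr
      linarith [Real.add_one_le_exp (2 : ℝ)]
    linarith
  calc (2 : ℝ) ^ k = 2 ^ (k + 1) * (1 / 2) := by rw [pow_succ]; ring
    _ ≤ _ := mul_le_mul h1 h2 (by norm_num) (le_trans (by positivity) h1)

lemma eq_zero_of_factor {z : ℂ} {k : ℕ} (hz : (z / (Real.exp (x k) : ℂ)) ^ m k = -1) :
    binomialProduct m x z = 0 := by
  refine tendsto_nhds_unique (h.tendsto_prod_range z) (tendsto_const_nhds.congr' ?_)
  filter_upwards [eventually_gt_atTop k] with n hn
  exact (Finset.prod_eq_zero (Finset.mem_range.2 hn) (by rw [hz]; ring)).symm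

/-- Near each point there is a zero. -/
lemma exists_zero (k : ℕ) {z : ℂ} {y : ℝ} (hz : ‖z‖ = Real.exp y) :
    ∃ u : ℂ, ‖u‖ ≤ |x k - y| + Real.pi / m k ∧ binomialProduct m x (z * Complex.exp u) = 0 := by
  have hm : (0 : ℝ) < m k := by exact_mod_cast h.one_le k
  have hπ := Real.pi_pos
  set θ := z.arg with hθ
  -- π (2j + 1) is an odd multiple of π within π of `m k * θ`, so a rotation by at most π / m k
  -- leads to a zero's argument.
  set j : ℤ := ⌊m k * θ / (2 * Real.pi)⌋ with hj
  have hj1 : (j : ℝ) * (2 * Real.pi) ≤ m k * θ :=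
    (le_div_iff₀ (by positivity)).1 (Int.floor_le _)
  have hj2 : (m k : ℝ) * θ < (j + 1) * (2 * Real.pi) :=
    (div_lt_iff₀ (by positivity)).1 (Int.lt_floor_add_one _)
  set α : ℝ := Real.pi * (2 * j + 1) / m k - θ with hα
  refine ⟨((x k - y : ℝ) : ℂ) + (α : ℂ) * Complex.I, ?_, ?_⟩
  · refine (norm_add_le _ _).trans ?_
    rw [Complex.norm_real, norm_mul, Complex.norm_I, mul_one, Complex.norm_real, Real.norm_eq_abs,
      Real.norm_eq_abs]
    gcongr
    have : α = (Real.pi * (2 * j + 1) - m k * θ) / m k := by rw [hα]; field_simp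
    rw [this, abs_div, abs_of_pos hm]
    gcongr
    rw [abs_le]
    constructor <;> linarith
  · apply h.eq_zero_of_factor (k := k)
    have hz' : z = Complex.exp (y + θ * Complex.I) := by
      conv_lhs => rw [← Complex.norm_mul_exp_arg_mul_I z, hz]
      rw [Complex.exp_add, Complex.ofReal_exp]
    have hmc : (m k : ℂ) ≠ 0 := by exact_mod_cast hm.ne'
    rw [hz', Complex.ofReal_exp, ← Complex.exp_add, ← Complex.exp_sub, ← Complex.exp_nat_mul]
    have : (m k : ℂ) * (y + θ * Complex.I + (((x k - y : ℝ) : ℂ) + (α : ℂ) * Complex.I) - x k)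
        = Real.pi * Complex.I + j * (2 * Real.pi * Complex.I) := by
      rw [hα]; push_cast; field_simp; ring
    rw [this, Complex.exp_add, Complex.exp_int_mul_two_pi_mul_I, Complex.exp_pi_mul_I, mul_one]

end IsSeparatedSystem

/-! ### Logarithmic derivative on the positive axis -/

/-- The `k`-th summand of the logarithmic derivative of `binomialProduct m x` with respect to
`y = log r`. -/
noncomputable def factorLogDeriv (m : ℕ → ℕ) (x : ℕ → ℝ) (y : ℝ) (k : ℕ) : ℝ :=
  m k * Real.exp (m k * (y - x k)) / (1 + Real.exp (m k * (y - x k)))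

lemma factorLogDeriv_nonneg (m : ℕ → ℕ) (x : ℕ → ℝ) (y : ℝ) (k : ℕ) :
    0 ≤ factorLogDeriv m x y k := by unfold factorLogDeriv; positivity

lemma factorLogDeriv_le (m : ℕ → ℕ) (x : ℕ → ℝ) (y : ℝ) (k : ℕ) :
    factorLogDeriv m x y k ≤ m k := by
  unfold factorLogDeriv
  rw [div_le_iff₀ (by positivity)]
  have : (0 : ℝ) ≤ m k := Nat.cast_nonneg _
  linarith

lemma factorLogDeriv_le_mul_exp (m : ℕ → ℕ) (x : ℕ → ℝ) (y : ℝ) (k : ℕ) :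
    factorLogDeriv m x y k ≤ m k * Real.exp (m k * (y - x k)) := by
  unfold factorLogDeriv
  refine div_le_self (by positivity) ?_
  linarith [Real.exp_pos (m k * (y - x k))]

lemma half_le_factorLogDeriv {m : ℕ → ℕ} {x : ℕ → ℝ} {y : ℝ} {k : ℕ} (hy : x k ≤ y) :
    (m k : ℝ) / 2 ≤ factorLogDeriv m x y k := by
  unfold factorLogDeriv
  have h1 : (1 : ℝ) ≤ Real.exp (m k * (y - x k)) :=
    Real.one_le_exp (mul_nonneg (Nat.cast_nonneg _) (sub_nonneg.2 hy))
  rw [div_le_div_iff₀ (by norm_num) (by positivity)]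
  have : (0 : ℝ) ≤ m k := Nat.cast_nonneg _
  nlinarith

namespace IsSeparatedSystem

variable {m : ℕ → ℕ} {x : ℕ → ℝ} (h : IsSeparatedSystem m x) (hm : ∀ k, m (k + 1) ≤ 2 * m k)
include h hm

/-- The exponents grow at most like 2^i while the powers decay like 4^{-i}. -/
lemma factorLogDeriv_tail_le {y : ℝ} {k : ℕ} (hy : y ≤ x k) (i : ℕ) :
    factorLogDeriv m x y (k + i) ≤ m k * (1 / 2) ^ i := by
  have h1 : (m (k + i) : ℝ) ≤ m k * 2 ^ i := by
    induction i with
    | zero => simp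
    | succ i ih =>
      have : (m (k + i + 1) : ℝ) ≤ 2 * m (k + i) := by exact_mod_cast hm (k + i)
      rw [← add_assoc, pow_succ]
      linarith
  calc _ ≤ _ := factorLogDeriv_le_mul_exp m x y (k + i)
    _ ≤ (m k * 2 ^ i) * (1 / 4) ^ i := by
      gcongr
      exact h.exp_exponent_le hy i
    _ = m k * (1 / 2) ^ i := by
      rw [mul_assoc, ← mul_pow]; norm_num

lemma summable_factorLogDeriv (y : ℝ) : Summable (factorLogDeriv m x y) := by
  obtain ⟨k, hk⟩ := (h.tendsto.eventually_ge_atTop y).exists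
  rw [← summable_nat_add_iff k]
  refine Summable.of_nonneg_of_le (fun i => factorLogDeriv_nonneg _ _ _ _)
    (fun i => ?_) (summable_geometric_two.mul_left (m k : ℝ))
  rw [add_comm i k]
  exact h.factorLogDeriv_tail_le hm hk i

lemma tsum_factorLogDeriv_le {y : ℝ} {k : ℕ} (hy : y ≤ x k) :
    ∑' i, factorLogDeriv m x y i ≤ ∑ i ∈ Finset.range k, (m i : ℝ) + 2 * m k := by
  have hs := h.summable_factorLogDeriv hm y
  rw [← hs.sum_add_tsum_nat_add k]
  refine add_le_add (Finset.sum_le_sum fun i _ => factorLogDeriv_le _ _ _ _) ?_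
  have h1 : ∑' i, factorLogDeriv m x y (i + k) ≤ ∑' i : ℕ, (m k : ℝ) * (1 / 2) ^ i := by
    refine ((summable_nat_add_iff k).2 hs).tsum_le_tsum (fun i => ?_)
      (summable_geometric_two.mul_left _)
    rw [add_comm i k]
    exact h.factorLogDeriv_tail_le hm hy i
  rw [tsum_mul_left, tsum_geometric_two] at h1
  linarith

/-- Shows that a(r) is unbounded, hence eventually at least t₀, where ψ is controlled. -/
lemma le_tsum_factorLogDeriv {y : ℝ} {k : ℕ} (hy : x k ≤ y) :
    (k : ℝ) / 2 ≤ ∑' i, factorLogDeriv m x y i := by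
  refine le_trans ?_ ((h.summable_factorLogDeriv hm y).sum_le_tsum (Finset.range k)
    fun i _ => factorLogDeriv_nonneg _ _ _ _)
  calc (k : ℝ) / 2 = ∑ i ∈ Finset.range k, (1 / 2 : ℝ) := by simp; ring
    _ ≤ _ := by
      refine Finset.sum_le_sum fun i hi => ?_
      have h1 : (1 : ℝ) ≤ m i := by exact_mod_cast h.one_le i
      exact le_trans (by linarith) (half_le_factorLogDeriv
        ((h.strictMono.monotone (Finset.mem_range.1 hi).le).trans hy))

/-- Locally uniform convergence allows termwise logarithmic differentiation. On the positive axis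
the product is positive, so its norm is its real part, and the chain rule for r = exp y cancels the
factor 1/r. -/
lemma hasDerivAt_log_norm (y : ℝ) :
    HasDerivAt (fun y : ℝ => Real.log ‖binomialProduct m x (Real.exp y)‖)
      (∑' k, factorLogDeriv m x y k) y := by
  have hre : ∀ y : ℝ, 0 < (binomialProduct m x (Real.exp y)).re := fun y => by
    have := (h.ofReal_value (Real.exp_pos y).le).2
    have h3 : 0 ≤ (Real.exp y / Real.exp (x 0)) ^ m 0 := by positivity
    linarith
  set r := Real.exp y with hr
  have hr0 : 0 < r := Real.exp_pos y
  have hpow : ∀ k, (((r : ℂ) / (Real.exp (x k) : ℂ)) ^ m k)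
      = ((Real.exp (m k * (y - x k)) : ℝ) : ℂ) := by
    intro k
    rw [Real.exp_nat_mul, Real.exp_sub, ← hr]; push_cast; rfl
  have hterm : ∀ k, logDeriv (fun z : ℂ => 1 + (z / (Real.exp (x k) : ℂ)) ^ m k) r
      = ((factorLogDeriv m x y k / r : ℝ) : ℂ) := by
    intro k
    have hmk : 1 ≤ m k := h.one_le k
    have hE : (Real.exp (x k) : ℂ) ≠ 0 := by exact_mod_cast (Real.exp_pos _).ne'
    have hrc : (r : ℂ) ≠ 0 := by exact_mod_cast hr0.ne'
    have hd : HasDerivAt (fun z : ℂ => 1 + (z / (Real.exp (x k) : ℂ)) ^ m k)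
        (m k * ((r : ℂ) / (Real.exp (x k) : ℂ)) ^ (m k - 1) * (1 / (Real.exp (x k) : ℂ))) r :=
      (((hasDerivAt_id' (r : ℂ)).div_const _).fun_pow (m k)).const_add 1
    rw [logDeriv_apply, hd.deriv, hpow]
    have h1 : (m k : ℂ) * ((r : ℂ) / (Real.exp (x k) : ℂ)) ^ (m k - 1)
        * (1 / (Real.exp (x k) : ℂ)) = m k * ((Real.exp (m k * (y - x k)) : ℝ) : ℂ) / r := by
      rw [← hpow k]
      obtain ⟨d, hd⟩ := Nat.exists_eq_add_of_le' hmk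
      rw [hd, Nat.add_sub_cancel, pow_succ]
      field_simp
    rw [h1, factorLogDeriv]
    push_cast
    rw [div_right_comm]
  have hsum := h.summable_factorLogDeriv hm y
  have hne : binomialProduct m x r ≠ 0 := fun h0 => by
    have := hre y
    rw [← hr, h0] at this
    simp at this
  have hlog : logDeriv (binomialProduct m x) r
      = ((∑' k, factorLogDeriv m x y k : ℝ) : ℂ) / r := by
    have := logDeriv_tprod_eq_tsum (s := univ) isOpen_univ (mem_univ (r : ℂ))
      (f := fun k z => 1 + (z / (Real.exp (x k) : ℂ)) ^ m k)
      (fun k => ?_) (fun k => by fun_prop) ?_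
      h.hasProdLocallyUniformlyOn.multipliableLocallyUniformlyOn hne
    · rw [show binomialProduct m x = fun z => ∏' k, (1 + (z / (Real.exp (x k) : ℂ)) ^ m k) from rfl,
        this]
      simp_rw [hterm]
      rw [← Complex.ofReal_tsum, tsum_div_const]
      push_cast; rfl
    · simp only [hpow]
      have : (0 : ℝ) < 1 + Real.exp (m k * (y - x k)) := by positivity
      exact_mod_cast this.ne'
    · simp_rw [hterm]
      exact Complex.hasSum_ofReal.2 (hsum.div_const r).hasSum |>.summable
  have hd := ((h.differentiable (r : ℂ)).hasDerivAt).real_of_complex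
  have hd2 := (hd.comp y (Real.hasDerivAt_exp y)).log
    (show ((fun t : ℝ => (binomialProduct m x t).re) ∘ Real.exp) y ≠ 0 from (hre y).ne')
  have hfun : (fun y : ℝ => Real.log ‖binomialProduct m x (Real.exp y)‖)
      = fun y => Real.log (((fun t : ℝ => (binomialProduct m x t).re) ∘ Real.exp) y) := by
    funext s
    rw [h.norm_ofReal (Real.exp_pos s).le]; rfl
  rw [hfun]
  convert hd2 using 1
  rw [logDeriv_apply, div_eq_iff hne] at hlog
  have hcast : binomialProduct m x r = ((binomialProduct m x r).re : ℂ) :=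
    Complex.ext (by simp) (by simp [(h.ofReal_value hr0.le).1])
  rw [hlog]
  have hre' := hre y
  rw [← hr] at hre'
  rw [hcast]
  simp only [Function.comp, ← hr]
  rw [← Complex.ofReal_div, ← Complex.ofReal_mul, Complex.ofReal_re]
  field_simp

end IsSeparatedSystem

/-! ### Level curves of the modulus -/

/-- Near a point where it does not vanish, a nonconstant analytic function is a multiple of
`exp (u ^ n)` for a local coordinate `u`. -/
lemma AnalyticAt.exists_eventuallyEq_mul_exp_pow {f : ℂ → ℂ} {p : ℂ} (hf : AnalyticAt ℂ f p)
    (hp : f p ≠ 0) (hc : ¬ ∀ᶠ z in 𝓝 p, f z = f p) :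
    ∃ (n : ℕ) (u : ℂ → ℂ), 1 ≤ n ∧ AnalyticAt ℂ u p ∧ u p = 0 ∧ deriv u p ≠ 0 ∧
      ∀ᶠ z in 𝓝 p, f z = f p * Complex.exp (u z ^ n) := by
  set l : ℂ → ℂ := fun z => Complex.log (f z / f p) with hl
  have hq : AnalyticAt ℂ (fun z => f z / f p) p := hf.div_const
  have hqp : f p / f p = 1 := div_self hp
  have hla : AnalyticAt ℂ l p := hq.clog (by simp [hqp])
  have hfl : ∀ᶠ z in 𝓝 p, f z = f p * Complex.exp (l z) := by
    filter_upwards [hf.continuousAt.eventually_ne hp] with z hz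
    rw [hl, Complex.exp_log (div_ne_zero hz hp), mul_div_cancel₀ _ hp]
  have hl0 : l p = 0 := by simp [hl]
  have hnc : ¬ ∀ᶠ z in 𝓝 p, l z = 0 := by
    intro h0
    apply hc
    filter_upwards [h0, hfl] with z h1 h2
    rw [h2, h1, Complex.exp_zero, mul_one]
  obtain ⟨n, g, hg, hgp, hlg⟩ := hla.exists_eventuallyEq_pow_smul_nonzero_iff.2 hnc
  have hn : n ≠ 0 := by
    rintro rfl
    have := hlg.self_of_nhds
    rw [hl0] at this
    simp at this
    exact hgp this.symm
  have hnc' : (n : ℂ) ≠ 0 := Nat.cast_ne_zero.2 hn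
  set b : ℂ := g p ^ (1 / n : ℂ) with hb
  have hbn : b ^ n = g p := by rw [hb, one_div, Complex.cpow_nat_inv_pow _ hn]
  have hb0 : b ≠ 0 := by
    rintro h0
    rw [h0, zero_pow hn] at hbn
    exact hgp hbn.symm
  -- An analytic n-th root of `g`: the quotient `g z / g p` is near 1, where the principal logarithm
  -- is analytic, and `b` is a root of `g p`.
  set v : ℂ → ℂ := fun z => b * Complex.exp (Complex.log (g z / g p) / n) with hv
  have hgq : AnalyticAt ℂ (fun z => g z / g p) p := hg.div_const
  have hva : AnalyticAt ℂ v p :=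
    analyticAt_const.mul (((hgq.clog (by simp [div_self hgp])).div_const).cexp)
  have hvp : v p = b := by simp [hv, div_self hgp]
  refine ⟨n, fun z => (z - p) * v z, Nat.one_le_iff_ne_zero.2 hn,
    (analyticAt_id.sub analyticAt_const).mul hva, by simp, ?_, ?_⟩
  · have h1 : HasDerivAt (fun z => (z - p) * v z) (1 * v p + (p - p) * deriv v p) p :=
      ((hasDerivAt_id' p).sub_const p).fun_mul hva.differentiableAt.hasDerivAt
    rw [h1.deriv, hvp]
    simpa using hb0
  · filter_upwards [hfl, hlg, hg.continuousAt.eventually_ne hgp] with z h1 h2 h3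
    rw [h1, h2, mul_pow, hv]
    congr 2
    rw [smul_eq_mul, mul_pow, hbn, ← Complex.exp_nat_mul, mul_div_cancel₀ _ hnc',
      Complex.exp_log (div_ne_zero h3 hgp), mul_div_cancel₀ _ hgp]

/-- Analytic inverse function theorem in one variable, on a disk. -/
lemma AnalyticAt.exists_inverse_on_ball {u : ℂ → ℂ} {p : ℂ} (hu : AnalyticAt ℂ u p) (hup : u p = 0)
    (hd : deriv u p ≠ 0) {V : Set ℂ} (hV : V ∈ 𝓝 p) :
    ∃ (φ : ℂ → ℂ) (δ : ℝ), 0 < δ ∧ φ 0 = p ∧ (∀ w ∈ Metric.ball 0 δ, AnalyticAt ℂ φ w ∧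
        deriv φ w ≠ 0 ∧ u (φ w) = w ∧ φ w ∈ V) ∧
      ∀ δ' ≤ δ, IsOpen (φ '' Metric.ball 0 δ') := by
  have hs : HasStrictDerivAt u (deriv u p) p := hu.hasStrictDerivAt
  set e := (hs.hasStrictFDerivAt_equiv hd).toOpenPartialHomeomorph u with he
  have heu : ∀ z, e z = u z := fun z => rfl
  have hps : p ∈ e.source := HasStrictFDerivAt.mem_toOpenPartialHomeomorph_source _
  have h0t : (0 : ℂ) ∈ e.target := by
    have := e.map_source hps
    rwa [heu, hup] at this
  have hsymm0 : e.symm 0 = p := by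
    have := e.left_inv hps
    rwa [heu, hup] at this
  have hda : HasDerivAt e (deriv u p) (e.symm 0) := by
    rw [hsymm0]; exact hs.hasDerivAt
  have hca : ContDiffAt ℂ ω e (e.symm 0) := by
    rw [hsymm0]; exact hu.contDiffAt
  have hφa : AnalyticAt ℂ e.symm 0 :=
    (e.contDiffAt_symm_deriv hd h0t hda hca).analyticAt
  have hφd : deriv e.symm 0 ≠ 0 := by
    rw [(e.hasDerivAt_symm h0t hd hda).deriv]
    exact inv_ne_zero hd
  have hev : ∀ᶠ w in 𝓝 (0 : ℂ), AnalyticAt ℂ e.symm w ∧ deriv e.symm w ≠ 0 ∧ w ∈ e.target ∧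
      e.symm w ∈ V := by
    refine hφa.eventually_analyticAt.and ((hφa.deriv.continuousAt.eventually_ne hφd).and
      ((e.open_target.eventually_mem h0t).and ?_))
    refine hφa.continuousAt.eventually ?_
    rw [hsymm0]; exact hV
  obtain ⟨δ, hδ, hball⟩ := Metric.eventually_nhds_iff_ball.1 hev
  refine ⟨e.symm, δ, hδ, hsymm0, fun w hw => ?_, fun δ' hδ' => ?_⟩
  · obtain ⟨h1, h2, h3, h4⟩ := hball w hw
    exact ⟨h1, h2, e.right_inv h3, h4⟩
  · refine e.symm.isOpen_image_of_subset_source Metric.isOpen_ball fun w hw => ?_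
    exact (hball w (Metric.ball_subset_ball hδ' hw)).2.2.1

/-- The unit vectors spanning the rays on which `w ^ n` is purely imaginary. -/
noncomputable def imaginaryRay (n : ℕ) (j : ℕ) : ℂ :=
  Complex.exp (((2 * j + 1) * Real.pi / (2 * n) : ℝ) * Complex.I)

lemma norm_imaginaryRay (n j : ℕ) : ‖imaginaryRay n j‖ = 1 :=
  Complex.norm_exp_ofReal_mul_I _

lemma re_pow_ofReal_mul_imaginaryRay {n : ℕ} (hn : 1 ≤ n) (j : ℕ) (s : ℝ) :
    (((s : ℂ) * imaginaryRay n j) ^ n).re = 0 := by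
  have hn' : (n : ℝ) ≠ 0 := by exact_mod_cast (by omega : n ≠ 0)
  rw [mul_pow, ← Complex.ofReal_pow, Complex.re_ofReal_mul, imaginaryRay, ← Complex.exp_nat_mul,
    ← mul_assoc, ← Complex.ofReal_natCast, ← Complex.ofReal_mul, Complex.exp_ofReal_mul_I_re,
    Real.cos_eq_zero_iff.2 ⟨j, ?_⟩, mul_zero]
  push_cast; field_simp

lemma exists_eq_mul_imaginaryRay {n : ℕ} (hn : 1 ≤ n) {w : ℂ} (hw : (w ^ n).re = 0) :
    ∃ j < 2 * n, w = (‖w‖ : ℂ) * imaginaryRay n j := by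
  have hn' : (n : ℝ) ≠ 0 := by exact_mod_cast (by omega : n ≠ 0)
  by_cases hw0 : w = 0
  · exact ⟨0, by omega, by simp [hw0]⟩
  have hpol := Complex.norm_mul_exp_arg_mul_I w
  rw [← hpol, mul_pow, ← Complex.ofReal_pow, Complex.re_ofReal_mul, ← Complex.exp_nat_mul,
    ← mul_assoc, ← Complex.ofReal_natCast, ← Complex.ofReal_mul, Complex.exp_ofReal_mul_I_re] at hw
  have hcos := (mul_eq_zero.1 hw).resolve_left (pow_pos (norm_pos_iff.2 hw0) n).ne'
  obtain ⟨k, hk⟩ := Real.cos_eq_zero_iff.1 hcos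
  -- The rays have period 2n in their index, so `k` is reduced modulo 2n; the quotient counts full
  -- turns.
  have h2n : (0 : ℤ) < 2 * n := by omega
  have hj0 := Int.emod_nonneg k h2n.ne'
  have hj1 := Int.emod_lt_of_pos k h2n
  have hkd : (2 * n : ℤ) * (k / (2 * n)) + k % (2 * n) = k := Int.mul_ediv_add_emod k (2 * n)
  set q := k / (2 * n) with hq
  obtain ⟨j, hj⟩ := Int.eq_ofNat_of_zero_le hj0
  refine ⟨j, by omega, ?_⟩
  conv_lhs => rw [← hpol]
  congr 1
  rw [imaginaryRay, Complex.exp_eq_exp_iff_exists_int]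
  refine ⟨q, ?_⟩
  have harg : w.arg = (2 * j + 1) * Real.pi / (2 * n) + q * (2 * Real.pi) := by
    rw [hj] at hkd
    have hkd' : (2 * n : ℝ) * q + j = k := by exact_mod_cast hkd
    rw [← hkd'] at hk
    field_simp
    linarith
  rw [harg]; push_cast; ring

lemma eq_of_ofReal_mul_imaginaryRay_eq {n : ℕ} (hn : 1 ≤ n) {i j : ℕ} (hi : i < 2 * n)
    (hj : j < 2 * n) {s t : ℝ} (hs : 0 < s) (ht : 0 ≤ t)
    (h : (s : ℂ) * imaginaryRay n i = t * imaginaryRay n j) : i = j := by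
  have hn' : (n : ℝ) ≠ 0 := by exact_mod_cast (by omega : n ≠ 0)
  have hst : s = t := by
    have := congrArg norm h
    simpa [norm_imaginaryRay, abs_of_pos hs, abs_of_nonneg ht] using this
  rw [← hst] at h
  have h' := mul_left_cancel₀ (by exact_mod_cast hs.ne') h
  rw [imaginaryRay, imaginaryRay, Complex.exp_eq_exp_iff_exists_int] at h'
  obtain ⟨q, hq⟩ := h'
  have hq' : (((2 * i + 1) * Real.pi / (2 * n) : ℝ) : ℂ)
      = (((2 * j + 1) * Real.pi / (2 * n) + q * (2 * Real.pi) : ℝ) : ℂ) := by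
    apply mul_right_cancel₀ Complex.I_ne_zero
    rw [hq]; push_cast; ring
  have hq2 := Complex.ofReal_injective hq'
  have hπ := Real.pi_ne_zero
  have hq3 : (2 * i + 1 : ℝ) = 2 * j + 1 + 4 * n * q := by
    field_simp at hq2
    linarith
  have hq4 : (2 * i + 1 : ℤ) = 2 * j + 1 + 4 * n * q := by exact_mod_cast hq3
  have hq5 : (i : ℤ) - j = 2 * n * q := by linarith
  have hq0 : q = 0 := by
    by_contra hne
    rcases lt_or_gt_of_ne hne with h1 | h1
    · have : (2 * n : ℤ) * q ≤ 2 * n * (-1) := by gcongr; omega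
      omega
    · have : (2 * n : ℤ) * 1 ≤ 2 * n * q := by gcongr; omega
      omega
  rw [hq0] at hq5
  omega

/-- A level set of the modulus of an entire function that is nowhere locally constant consists of
piecewise smooth curves. -/
theorem consistsOfPiecewiseSmoothCurves_norm_eq {f : ℂ → ℂ} (hf : Differentiable ℂ f)
    (hc : ∀ p, ¬ ∀ᶠ z in 𝓝 p, f z = f p) {R : ℝ} (hR : 0 < R) :
    ConsistsOfPiecewiseSmoothCurves {z | ‖f z‖ = R} := by
  intro p hp
  have hpR : ‖f p‖ = R := hp
  have hp0 : f p ≠ 0 := norm_pos_iff.1 (hpR ▸ hR)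
  obtain ⟨n, u, hn, hua, hup, hud, hfu⟩ :=
    (hf.analyticAt p).exists_eventuallyEq_mul_exp_pow hp0 (hc p)
  obtain ⟨φ, δ, hδ, hφ0, hφ, hopen⟩ := hua.exists_inverse_on_ball hup hud hfu
  -- In the coordinate w the modulus is R exp(Re w^n), so the level set becomes 2n rays.
  have hnorm : ∀ w ∈ Metric.ball (0 : ℂ) δ, (‖f (φ w)‖ = R ↔ (w ^ n).re = 0) := by
    intro w hw
    obtain ⟨-, -, h3, h4⟩ := hφ w hw
    have h4' : f (φ w) = f p * Complex.exp (u (φ w) ^ n) := h4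
    rw [h4', h3, norm_mul, hpR, Complex.norm_exp, mul_eq_left₀ hR.ne', Real.exp_eq_one_iff]
  set c : ℕ → ℂ := fun j => ((δ / 2 : ℝ) : ℂ) * imaginaryRay n j with hcdef
  have hcnorm : ∀ j, ‖c j‖ = δ / 2 := fun j => by
    rw [hcdef, norm_mul, norm_imaginaryRay, mul_one, Complex.norm_real,
      Real.norm_of_nonneg (by positivity)]
  have hc0 : ∀ j, c j ≠ 0 := fun j => norm_pos_iff.1 (by rw [hcnorm]; positivity)
  have hmem : ∀ t ∈ Icc (0 : ℝ) 1, ∀ j, (t : ℂ) * c j ∈ Metric.ball (0 : ℂ) δ := by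
    intro t ht j
    rw [mem_ball_zero_iff, norm_mul, hcnorm, Complex.norm_real, Real.norm_of_nonneg ht.1]
    nlinarith [ht.2]
  have hinj : InjOn φ (Metric.ball 0 δ) := fun a ha b hb hab => by
    rw [← (hφ a ha).2.2.1, ← (hφ b hb).2.2.1, hab]
  have hder : ∀ t ∈ Icc (0 : ℝ) 1, ∀ j,
      HasDerivAt (fun t : ℝ => φ ((t : ℂ) * c j)) (c j * deriv φ ((t : ℂ) * c j)) t := by
    intro t ht j
    have h1 : HasDerivAt (fun t : ℝ => (t : ℂ) * c j) (c j) t := by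
      simpa using (hasDerivAt_id t).ofReal_comp.mul_const (c j)
    exact HasDerivAt.scomp t ((hφ _ (hmem t ht j)).1.differentiableAt.hasDerivAt) h1
  -- Segments of length δ/2 cross the smaller ball completely, yet their closed ends stay where `φ`
  -- is analytic.
  refine ⟨φ '' Metric.ball 0 (δ / 2), hopen _ (by linarith),
    ⟨0, by simpa using hδ, hφ0⟩, 2 * n, fun j t => φ ((t : ℂ) * c j), fun j => ⟨⟨?_, ?_, ?_⟩, ?_⟩,
    fun i j hij => ?_, ?_⟩
  · intro t ht
    have h1 : ContDiffAt ℝ ∞ φ ((t : ℂ) * c j) :=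
      ((hφ _ (hmem t ht j)).1.contDiffAt (n := ∞)).restrict_scalars ℝ
    have h2 : ContDiffAt ℝ ∞ (fun t : ℝ => (t : ℂ) * c j) t :=
      (Complex.ofRealCLM.contDiff.mul contDiff_const).contDiffAt
    exact (h1.comp t h2).contDiffWithinAt
  · intro s hs t ht hst
    have := hinj (hmem s hs j) (hmem t ht j) hst
    exact_mod_cast mul_right_cancel₀ (hc0 j) this
  · intro t ht
    rw [(hder t ht j).hasDerivWithinAt.derivWithin (uniqueDiffOn_Icc zero_lt_one t ht)]
    exact mul_ne_zero (hc0 j) (hφ _ (hmem t ht j)).2.1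
  · simp [hφ0]
  · apply Subset.antisymm
    · rintro z ⟨⟨s, hs, rfl⟩, ⟨t, ht, hst⟩⟩
      have h1 := hinj (hmem t ht j) (hmem s hs i) hst
      rcases hs.1.eq_or_lt with h0 | h0
      · rw [← h0]; simp [hφ0]
      · exfalso
        apply hij
        ext
        refine eq_of_ofReal_mul_imaginaryRay_eq hn i.2 j.2 (s := s * (δ / 2)) (t := t * (δ / 2))
          (by positivity) (mul_nonneg ht.1 (by positivity)) ?_
        rw [hcdef] at h1
        simp only [← mul_assoc, ← Complex.ofReal_mul] at h1
        exact h1.symm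
    · rintro z rfl
      exact ⟨⟨0, by simp, by simp [hφ0]⟩, ⟨0, by simp, by simp [hφ0]⟩⟩
  · ext z
    refine and_congr_left fun hzU => ⟨fun hz => ?_, fun hz => ?_⟩
    · obtain ⟨w, hw, rfl⟩ := hzU
      rw [mem_ball_zero_iff] at hw
      have hw' : w ∈ Metric.ball (0 : ℂ) δ := by rw [mem_ball_zero_iff]; linarith
      obtain ⟨j, hj, hwj⟩ := exists_eq_mul_imaginaryRay hn ((hnorm w hw').1 hz)
      refine mem_iUnion.2 ⟨⟨j, hj⟩, ‖w‖ / (δ / 2), ⟨by positivity, ?_⟩, ?_⟩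
      · rw [div_le_one (by positivity)]; exact hw.le
      · have hδc : (δ : ℂ) ≠ 0 := by exact_mod_cast hδ.ne'
        have : ((‖w‖ / (δ / 2) : ℝ) : ℂ) * c j = w := by
          conv_rhs => rw [hwj]
          rw [hcdef]; push_cast; field_simp
        exact congrArg φ this
    · obtain ⟨j, t, ht, rfl⟩ := mem_iUnion.1 hz
      refine (hnorm _ (hmem t ht j)).2 ?_
      rw [hcdef]
      simp only
      rw [← mul_assoc, ← Complex.ofReal_mul]
      exact re_pow_ofReal_mul_imaginaryRay hn j _

/-! ### Uniqueness of the tract and failure of the asymptotics -/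

section Tract

variable {f : ℂ → ℂ}

/-- A component inside a large circle would be bounded with |f| ≤ R on its frontier, against the
maximum principle. So components of inner points meet the circle, which is connected and lies in the
set. -/
lemma isPreconnected_lt_norm (hf : Differentiable ℂ f) {R : ℝ}
    (hcirc : ∀ r : ℝ, ∃ s > r, ∀ z, ‖z‖ = s → R < ‖f z‖) :
    IsPreconnected {z | R < ‖f z‖} := by
  set S : Set ℂ := {z | R < ‖f z‖} with hS
  have hSo : IsOpen S := isOpen_lt continuous_const hf.continuous.norm
  refine isPreconnected_of_forall_pair fun a ha b hb => ?_
  obtain ⟨s, hs, hsS⟩ := hcirc (max ‖a‖ ‖b‖)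
  have hsphere : Metric.sphere (0 : ℂ) s ⊆ S := fun z hz => hsS z (mem_sphere_zero_iff_norm.1 hz)
  have hspc : IsPreconnected (Metric.sphere (0 : ℂ) s) :=
    isPreconnected_sphere (by rw [Complex.rank_real_complex]; norm_num) 0 s
  have hcomp : ∀ z ∈ S, ‖z‖ < s → (connectedComponentIn S z ∩ Metric.sphere 0 s).Nonempty := by
    intro z hz hzs
    by_contra hne
    rw [not_nonempty_iff_eq_empty] at hne
    set U := connectedComponentIn S z with hU
    have hUo : IsOpen U := hSo.connectedComponentIn
    have hzU : z ∈ U := mem_connectedComponentIn hz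
    have hUS : U ⊆ S := connectedComponentIn_subset S z
    have hUb : U ⊆ Metric.ball 0 s := by
      refine isPreconnected_connectedComponentIn.subset_of_closure_inter_subset
        Metric.isOpen_ball ⟨z, hzU, by simpa using hzs⟩ ?_
      rintro w ⟨hw1, hw2⟩
      have hw3 := Metric.closure_ball_subset_closedBall hw1
      rw [mem_closedBall_zero_iff] at hw3
      rw [mem_ball_zero_iff]
      refine lt_of_le_of_ne hw3 fun hw4 => ?_
      have : w ∈ U ∩ Metric.sphere 0 s := ⟨hw2, mem_sphere_zero_iff_norm.2 hw4⟩
      rw [hne] at this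
      exact this
    have hfr : ∀ w ∈ frontier U, ‖f w‖ ≤ R := by
      intro w hw
      by_contra! hwR
      have hwS : w ∈ S := hwR
      have hop : IsOpen (connectedComponentIn S w) := hSo.connectedComponentIn
      have hwc : w ∈ closure U := frontier_subset_closure hw
      obtain ⟨v, hv1, hv2⟩ := mem_closure_iff.1 hwc _ hop (mem_connectedComponentIn hwS)
      have h1 := connectedComponentIn_eq hv1
      have h2 := connectedComponentIn_eq hv2
      have : w ∈ U := by
        rw [hU, h2, ← h1]; exact mem_connectedComponentIn hwS
      rw [hUo.frontier_eq] at hw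
      exact hw.2 this
    have := Complex.norm_le_of_forall_mem_frontier_norm_le (Metric.isBounded_ball.subset hUb)
      hf.diffContOnCl hfr (subset_closure hzU)
    exact absurd hz (not_lt.2 this)
  have hsub : ∀ z ∈ S, ‖z‖ < s → IsPreconnected (connectedComponentIn S z ∪ Metric.sphere 0 s) :=
    fun z hz hzs => isPreconnected_connectedComponentIn.union' (hcomp z hz hzs) hspc
  have hne : (Metric.sphere (0 : ℂ) s).Nonempty := (hcomp a ha
    ((le_max_left _ _).trans_lt hs)).mono inter_subset_right
  refine ⟨(connectedComponentIn S a ∪ Metric.sphere 0 s)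
      ∪ (connectedComponentIn S b ∪ Metric.sphere 0 s), ?_,
    Or.inl (Or.inl (mem_connectedComponentIn ha)), Or.inr (Or.inl (mem_connectedComponentIn hb)),
    ?_⟩
  · exact union_subset (union_subset (connectedComponentIn_subset _ _) hsphere)
      (union_subset (connectedComponentIn_subset _ _) hsphere)
  · refine (hsub a ha ((le_max_left _ _).trans_lt hs)).union' ?_
      (hsub b hb ((le_max_right _ _).trans_lt hs))
    exact hne.mono fun w hw => ⟨Or.inr hw, Or.inr hw⟩

/-- A point of the level set off the closure would be a local maximum of |f|, forcing `f` to be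
locally constant. -/
lemma frontier_lt_norm (hf : Differentiable ℂ f) (hc : ∀ p, ¬ ∀ᶠ z in 𝓝 p, f z = f p) (R : ℝ) :
    frontier {z | R < ‖f z‖} = {z | ‖f z‖ = R} := by
  apply Subset.antisymm
  · exact (frontier_lt_subset_eq continuous_const hf.continuous.norm).trans
      fun z hz => (show R = ‖f z‖ from hz).symm
  · intro p hp
    have hpR : ‖f p‖ = R := hp
    have hSo : IsOpen {z | R < ‖f z‖} := isOpen_lt continuous_const hf.continuous.norm
    rw [hSo.frontier_eq]
    refine ⟨?_, fun h : R < ‖f p‖ => h.ne' hpR⟩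
    by_contra hcl
    apply hc p
    refine Complex.eventually_eq_of_isLocalMax_norm (.of_forall fun z => hf z) ?_
    filter_upwards [isClosed_closure.isOpen_compl.mem_nhds hcl] with z hz
    have : ¬ R < ‖f z‖ := fun h => hz (subset_closure h)
    simp only [Function.comp]
    linarith

/-- If `|f|` is large on a sequence of circles and `f` has infinitely many zeros, then the set
where `|f| > R` is the unique direct tract of level `R`. -/
theorem isDirectTractOfLevel_iff (hf : Differentiable ℂ f)
    (hc : ∀ p, ¬ ∀ᶠ z in 𝓝 p, f z = f p)
    {R : ℝ} (hR : 0 < R) (hcirc : ∀ r : ℝ, ∃ s > r, ∀ z, ‖z‖ = s → R < ‖f z‖)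
    (hzero : ∀ r : ℝ, ∃ z, r < ‖z‖ ∧ f z = 0) (D : Set ℂ) :
    IsDirectTractOfLevel f D R ↔ D = {z | R < ‖f z‖} := by
  have hSo : IsOpen {z | R < ‖f z‖} := isOpen_lt continuous_const hf.continuous.norm
  have hSc := isPreconnected_lt_norm hf hcirc
  have hfr := frontier_lt_norm hf hc R
  have hub : ∀ r : ℝ, ∃ z, r < ‖z‖ ∧ R < ‖f z‖ := fun r => by
    obtain ⟨s, hs, hsS⟩ := hcirc (max r 0)
    have hs0 : ‖(s : ℂ)‖ = s := by
      rw [Complex.norm_real, Real.norm_of_nonneg ((le_max_right _ _).trans hs.le)]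
    exact ⟨s, by rw [hs0]; exact (le_max_left _ _).trans_lt hs, hsS _ hs0⟩
  constructor
  · intro hD
    apply Subset.antisymm
    · exact fun z hz => hD.lt_norm z hz
    · obtain ⟨d, hd⟩ := hD.isConnected.nonempty
      -- `D` is relatively closed in {|f| > R} because |f| = R on its frontier.
      refine hSc.subset_of_closure_inter_subset hD.isOpen ⟨d, hD.lt_norm d hd, hd⟩ ?_
      rintro z ⟨hz1, hz2⟩
      by_contra hzD
      have : z ∈ frontier D := by rw [hD.isOpen.frontier_eq]; exact ⟨hz1, hzD⟩
      exact (show R < ‖f z‖ from hz2).ne' (hD.norm_eq z this)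
  · rintro rfl
    refine ⟨hSo, ⟨?_, hSc⟩, ?_, ?_, ?_, hf.differentiableOn, hf.continuous.continuousOn, hR, ?_,
      fun z hz => hz⟩
    · obtain ⟨z, -, hz⟩ := hub 0
      exact ⟨z, hz⟩
    · intro hb
      obtain ⟨C, hC⟩ := hb.exists_norm_le
      obtain ⟨z, hz1, hz2⟩ := hub C
      exact (hC z hz2).not_gt hz1
    · intro hb
      obtain ⟨C, hC⟩ := hb.exists_norm_le
      obtain ⟨z, hz1, hz2⟩ := hzero C
      refine (hC z ?_).not_gt hz1
      intro h
      have h' : R < ‖f z‖ := h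
      rw [hz2, norm_zero] at h'
      exact h'.not_gt hR
    · rw [hfr]
      exact consistsOfPiecewiseSmoothCurves_norm_eq hf hc hR
    · rw [hfr]
      exact fun z hz => hz

lemma isTractMaxPoint_ofReal {R r : ℝ} (hr : 0 ≤ r) (hmax : ∀ z, ‖f z‖ ≤ ‖f (‖z‖ : ℝ)‖)
    (hfr : R < ‖f r‖) : IsTractMaxPoint r f {z | R < ‖f z‖} r := by
  have hn : ‖(r : ℂ)‖ = r := by rw [Complex.norm_real, Real.norm_of_nonneg hr]
  refine ⟨hfr, hn, ?_⟩
  have : IsGreatest ((fun z => ‖f z‖) '' {z | z ∈ {z | R < ‖f z‖} ∧ ‖z‖ = r}) ‖f r‖ := by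
    refine ⟨⟨r, ⟨hfr, hn⟩, rfl⟩, ?_⟩
    rintro _ ⟨z, ⟨-, hz⟩, rfl⟩
    rw [← hz]
    exact hmax z
  exact this.csSup_eq.symm

lemma HasFiniteLogMeasure.exists_notMem {F : Set ℝ} (hF : HasFiniteLogMeasure F) (r₀ : ℝ) :
    ∃ r ≥ r₀, r ∉ F := by
  by_contra! h
  set s := max r₀ 1 with hs
  have hs0 : 0 < s := lt_of_lt_of_le one_pos (le_max_right _ _)
  have hsub : Ioi s ⊆ F := fun r hr => h r ((le_max_left _ _).trans (mem_Ioi.1 hr).le)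
  have hfin : ∫⁻ t in Ioi s, ENNReal.ofReal (1 / t) < ⊤ :=
    (lintegral_mono_set hsub).trans_lt hF.2
  apply not_integrableOn_Ioi_inv (a := s)
  refine ⟨measurable_inv.aestronglyMeasurable, ?_⟩
  rw [hasFiniteIntegral_iff_ofReal]
  · simpa only [one_div] using hfin
  · filter_upwards [self_mem_ae_restrict measurableSet_Ioi] with t ht
    exact inv_nonneg.2 (hs0.trans ht).le

/-- At a zero in the disk the quotient is 0 whatever its denominator, so ε = 1 already fails; some
large r avoids `F` because a ray has infinite logarithmic measure. -/
lemma not_wimanValironAsymptotics {ψ : ℝ → ℝ} {D : Set ℂ} {zr : ℝ → ℂ}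
    (hzero : ∀ᶠ r : ℝ in atTop, ∀ z : ℂ, ‖z‖ = r →
      ∃ w ∈ Metric.ball z (r / √(ψ (tractLogDeriv r f D))), f w = 0)
    (hzr : ∀ᶠ r : ℝ in atTop, IsTractMaxPoint r f D (zr r)) {F : Set ℝ}
    (hF : HasFiniteLogMeasure F) : ¬ WimanValironAsymptotics ψ f D zr F := by
  intro h
  obtain ⟨r₀, hr₀⟩ := eventually_atTop.1 ((h 1 one_pos).and (hzero.and hzr))
  obtain ⟨r, hr, hrF⟩ := hF.exists_notMem r₀
  obtain ⟨h1, h2, h3⟩ := hr₀ r hr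
  obtain ⟨w, hw, hfw⟩ := h2 (zr r) h3.2.1
  have := h1 hrF w (by rw [← dist_eq_norm]; exact (Metric.mem_ball.1 hw).le)
  rw [hfw, zero_div, zero_sub, norm_neg, norm_one] at this
  exact lt_irrefl _ this

end Tract

/-! ### Tracts of the product and conclusion -/

namespace IsSeparatedSystem

variable {m : ℕ → ℕ} {x : ℕ → ℝ} (h : IsSeparatedSystem m x)
include h

lemma not_eventually_const (p : ℂ) :
    ¬ ∀ᶠ z in 𝓝 p, binomialProduct m x z = binomialProduct m x p := by
  intro hp
  have hconst : binomialProduct m x = fun _ => binomialProduct m x p :=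
    AnalyticOnNhd.eq_of_eventuallyEq (fun z _ => h.differentiable.analyticAt z)
      (fun z _ => analyticAt_const) hp
  obtain ⟨r, hr⟩ := (h.tendsto_norm_ofReal.eventually_gt_atTop ‖binomialProduct m x p‖).exists
  rw [congrFun hconst r] at hr
  exact lt_irrefl _ hr

lemma exists_circle (R r : ℝ) : ∃ s > r, ∀ z, ‖z‖ = s → R < ‖binomialProduct m x z‖ := by
  have h1 : Tendsto (fun k => Real.exp (x k)) atTop atTop := Real.tendsto_exp_atTop.comp h.tendsto
  have h2 : Tendsto (fun k : ℕ => (2 : ℝ) ^ k) atTop atTop :=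
    tendsto_pow_atTop_atTop_of_one_lt (by norm_num)
  obtain ⟨k, hk1, hk2⟩ := ((h1.eventually_gt_atTop r).and (h2.eventually_gt_atTop R)).exists
  refine ⟨Real.exp ((x k + x (k + 1)) / 2), hk1.trans_le (Real.exp_le_exp.2 ?_), fun z hz =>
    hk2.trans_le (h.two_pow_le_norm hz)⟩
  linarith [h.strictMono (Nat.lt_succ_self k)]

lemma exists_zero_gt (r : ℝ) : ∃ z, r < ‖z‖ ∧ binomialProduct m x z = 0 := by
  have h1 : Tendsto (fun k => Real.exp (x k)) atTop atTop := Real.tendsto_exp_atTop.comp h.tendsto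
  obtain ⟨k, hk⟩ := (h1.eventually_gt_atTop r).exists
  have hm : (m k : ℂ) ≠ 0 := Nat.cast_ne_zero.2 (by have := h.one_le k; omega)
  refine ⟨Real.exp (x k) * Complex.exp ((Real.pi / m k : ℝ) * Complex.I), ?_,
    h.eq_zero_of_factor (k := k) ?_⟩
  · rwa [norm_mul, Complex.norm_exp_ofReal_mul_I, mul_one, Complex.norm_real,
      Real.norm_of_nonneg (Real.exp_pos _).le]
  · rw [mul_div_cancel_left₀ _ (by exact_mod_cast (Real.exp_pos _).ne'), ← Complex.exp_nat_mul,
      ← Complex.exp_pi_mul_I]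
    congr 1
    push_cast; field_simp

lemma eventually_isTractMaxPoint (R : ℝ) : ∀ᶠ r : ℝ in atTop,
    IsTractMaxPoint r (binomialProduct m x) {z | R < ‖binomialProduct m x z‖} r := by
  filter_upwards [eventually_ge_atTop 0, h.tendsto_norm_ofReal.eventually_gt_atTop R] with r h1 h2
  exact isTractMaxPoint_ofReal h1 h.norm_le h2

lemma eventually_hasDerivAt_logTractMaxModulus (hm : ∀ k, m (k + 1) ≤ 2 * m k) (R : ℝ) :
    ∀ᶠ y : ℝ in atTop, HasDerivAt
      (logTractMaxModulus (binomialProduct m x) {z | R < ‖binomialProduct m x z‖})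
      (∑' k, factorLogDeriv m x y k) y := by
  obtain ⟨y₀, hy₀⟩ := eventually_atTop.1
    (Real.tendsto_exp_atTop.eventually (h.eventually_isTractMaxPoint R))
  filter_upwards [eventually_gt_atTop y₀] with y hy
  refine (h.hasDerivAt_log_norm hm y).congr_of_eventuallyEq ?_
  filter_upwards [Ioi_mem_nhds hy] with s hs
  rw [logTractMaxModulus, ← (hy₀ s (mem_Ioi.1 hs).le).2.2]

end IsSeparatedSystem

lemma exists_mem_Ico_succ_of_tendsto_atTop {x : ℕ → ℝ} (ht : Tendsto x atTop atTop)
    {y : ℝ} (hy : x 0 ≤ y) : ∃ k, x k ≤ y ∧ y < x (k + 1) := by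
  obtain ⟨j, hj⟩ := (ht.eventually_gt_atTop y).exists
  classical
  have hex : ∃ j, y < x j := ⟨j, hj⟩
  have h1 := Nat.find_spec hex
  obtain ⟨k, hk⟩ : ∃ k, Nat.find hex = k + 1 := by
    refine Nat.exists_eq_succ_of_ne_zero fun h0 => ?_
    rw [h0] at h1
    linarith
  rw [hk] at h1
  exact ⟨k, not_lt.1 (Nat.find_min hex (by omega)), h1⟩

/-- The radial offset and the angular offset π / m k are each at most 1/(16 φ). The exponential at
most doubles their sum, giving relative distance 1/(4 φ) < 1/(2 φ) ≤ 1/q. -/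
lemma exists_zero_mem_ball {m : ℕ → ℕ} {x : ℕ → ℝ} (h : IsSeparatedSystem m x) {k : ℕ} {y φ q : ℝ}
    (hy : x k ≤ y) (hy' : y ≤ x (k + 1)) (hφ : 1 ≤ φ) (hx : x (k + 1) - x k = 1 / (16 * φ))
    (hmk : 64 * φ ≤ m k) (hq0 : 0 < q) (hq : q ≤ 2 * φ) {z : ℂ} (hz : ‖z‖ = Real.exp y) :
    ∃ w ∈ Metric.ball z (Real.exp y / q), binomialProduct m x w = 0 := by
  obtain ⟨u, hu, hfu⟩ := h.exists_zero k hz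
  refine ⟨_, ?_, hfu⟩
  have hφ0 : 0 < φ := by linarith
  have h1 : |x k - y| ≤ 1 / (16 * φ) := by
    rw [abs_sub_comm, abs_of_nonneg (by linarith)]; linarith
  have h2 : Real.pi / m k ≤ 1 / (16 * φ) := by
    have hmk0 : (0 : ℝ) < m k := by linarith
    rw [div_le_div_iff₀ hmk0 (by positivity)]
    nlinarith [Real.pi_le_four]
  have h3 : ‖u‖ ≤ 1 / (8 * φ) := by
    refine hu.trans ((add_le_add h1 h2).trans (le_of_eq ?_))
    field_simp; norm_num
  have h4 : ‖u‖ ≤ 1 := h3.trans (by rw [div_le_one (by positivity)]; linarith)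
  have h5 : ‖z * Complex.exp u - z‖ ≤ Real.exp y * (2 * ‖u‖) := by
    rw [← mul_sub_one, norm_mul, hz]
    gcongr
    exact Complex.norm_exp_sub_one_le h4
  rw [mem_ball_iff_norm]
  refine h5.trans_lt ?_
  rw [div_eq_mul_inv]
  gcongr
  calc 2 * ‖u‖ ≤ 2 * (1 / (8 * φ)) := by gcongr
    _ = (4 * φ)⁻¹ := by field_simp; norm_num
    _ < q⁻¹ := by
      apply inv_strictAnti₀ hq0
      linarith

theorem theorem2 (t₀ L : ℝ) (ψ : ℝ → ℝ) (ht₀ : 0 < t₀)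
    (hpos : ∀ t ∈ Ici t₀, 0 < ψ t)
    (hdiff : DifferentiableOn ℝ ψ (Ici t₀))
    (hdiv : Tendsto (fun T : ℝ => ∫ t in t₀..T, 1 / ψ t) atTop atTop)
    (hreg : ∀ t ∈ Ici t₀, 1 ≤ t * derivWithin ψ (Ici t₀) t / ψ t ∧
      t * derivWithin ψ (Ici t₀) t / ψ t ≤ L)
    (hL : L < 6 / 5) :
    ∃ f : ℂ → ℂ, Differentiable ℂ f ∧ IsBinomialProduct f ∧
      (∀ R : ℝ, 0 < R → ∃! D : Set ℂ, IsDirectTractOfLevel f D R) ∧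
      ∀ D : Set ℂ, IsDirectTract f D →
        (∀ᶠ r : ℝ in atTop,
          (∃ z : ℂ, IsTractMaxPoint r f D z) ∧
          DifferentiableWithinAt ℝ (logTractMaxModulus f D) (Ioi (Real.log r)) (Real.log r) ∧
          t₀ ≤ tractLogDeriv r f D ∧
          ∀ z : ℂ, ‖z‖ = r →
            (∃ w ∈ Metric.ball z (r / √(ψ (tractLogDeriv r f D))), f w = 0) ∧
            ¬ Metric.ball z (r / √(ψ (tractLogDeriv r f D))) ⊆ D) ∧
        ∀ zr : ℝ → ℂ, (∀ᶠ r : ℝ in atTop, IsTractMaxPoint r f D (zr r)) →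
          ∀ F : Set ℝ, HasFiniteLogMeasure F → ¬ WimanValironAsymptotics ψ f D zr F := by
  obtain ⟨hmono, m, n, x, h, hk⟩ := exists_isSeparatedSystem ht₀ hpos hdiff hdiv hreg hL
  have hm : ∀ k, m (k + 1) ≤ 2 * m k := fun k => (hk k).1
  have hlevel : ∀ R : ℝ, 0 < R → ∀ D, IsDirectTractOfLevel (binomialProduct m x) D R ↔
      D = {z | R < ‖binomialProduct m x z‖} := fun R hR =>
    isDirectTractOfLevel_iff h.differentiable h.not_eventually_const hR (h.exists_circle R)
      h.exists_zero_gt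
  refine ⟨binomialProduct m x, h.differentiable, h.isBinomialProduct, fun R hR =>
    ⟨_, (hlevel R hR _).2 rfl, fun D hD => (hlevel R hR D).1 hD⟩, ?_⟩
  rintro D ⟨R, hD⟩
  have hR := hD.level_pos
  have hDeq := (hlevel R hR D).1 hD
  suffices hmain : ∀ᶠ r : ℝ in atTop,
      (∃ z : ℂ, IsTractMaxPoint r (binomialProduct m x) D z) ∧
      DifferentiableWithinAt ℝ (logTractMaxModulus (binomialProduct m x) D)
        (Ioi (Real.log r)) (Real.log r) ∧
      t₀ ≤ tractLogDeriv r (binomialProduct m x) D ∧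
      ∀ z : ℂ, ‖z‖ = r →
        ∃ w ∈ Metric.ball z (r / √(ψ (tractLogDeriv r (binomialProduct m x) D))),
          binomialProduct m x w = 0 by
    refine ⟨?_, fun zr hzr F hF => not_wimanValironAsymptotics
      (hmain.mono fun r hr => hr.2.2.2) hzr hF⟩
    filter_upwards [hmain] with r hr
    refine ⟨hr.1, hr.2.1, hr.2.2.1, fun z hz => ⟨hr.2.2.2 z hz, fun hsub => ?_⟩⟩
    obtain ⟨w, hw, hfw⟩ := hr.2.2.2 z hz
    have := hD.lt_norm w (hsub hw)
    rw [hfw, norm_zero] at this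
    exact this.not_gt hR
  obtain ⟨k₀, hk₀⟩ := exists_nat_ge (2 * t₀)
  filter_upwards [eventually_gt_atTop 0, h.eventually_isTractMaxPoint R,
    Real.tendsto_log_atTop.eventually (h.eventually_hasDerivAt_logTractMaxModulus hm R),
    Real.tendsto_log_atTop.eventually_ge_atTop (x k₀)] with r hr0 hmax hder hxr
  rw [← hDeq] at hmax hder
  have ha : tractLogDeriv r (binomialProduct m x) D = ∑' k, factorLogDeriv m x (Real.log r) k :=
    hder.hasDerivWithinAt.derivWithin (uniqueDiffWithinAt_Ioi _)
  have hat : t₀ ≤ tractLogDeriv r (binomialProduct m x) D := by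
    rw [ha]
    refine le_trans ?_ (h.le_tsum_factorLogDeriv hm hxr)
    linarith
  refine ⟨⟨r, hmax⟩, hder.differentiableAt.differentiableWithinAt, hat, fun z hz => ?_⟩
  obtain ⟨k, hk1, hk2⟩ := exists_mem_Ico_succ_of_tendsto_atTop h.tendsto
    ((h.strictMono.monotone (Nat.zero_le k₀)).trans hxr)
  obtain ⟨-, hsum, htn, hxk, hmk, hone, hdbl⟩ := hk k
  -- As log r < `x (k + 1)`, the tail starts at k + 1 and costs 2 m_{k+1} ≤ 4 m_k.
  have hale : tractLogDeriv r (binomialProduct m x) D ≤ 2 * n k := by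
    rw [ha]
    refine (h.tsum_factorLogDeriv_le hm hk2.le).trans ?_
    have h1 : (m (k + 1) : ℝ) ≤ 2 * m k := by exact_mod_cast hm k
    have h2 : ∑ i ∈ Finset.range (k + 1), (m i : ℝ) + 4 * m k ≤ 2 * n k := by exact_mod_cast hsum
    linarith
  have hrexp : Real.exp (Real.log r) = r := Real.exp_log hr0
  have hq0 : 0 < √(ψ (tractLogDeriv r (binomialProduct m x) D)) := Real.sqrt_pos.2 (hpos _ hat)
  have hq : √(ψ (tractLogDeriv r (binomialProduct m x) D)) ≤ 2 * √(ψ (n k)) :=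
    (Real.sqrt_le_sqrt (hmono hat (hat.trans hale) hale)).trans hdbl
  have := exists_zero_mem_ball h hk1 hk2.le hone hxk hmk hq0 hq (hz.trans hrexp.symm)
  rwa [hrexp] at this
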